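/- Let $p>0$ be real. For every integer $k\ge 1$ let $\lambda_k$ be the unique root of $p\sin(\pi x)+x\cos(\pi x)=0$ in $(k-\tfrac12,k)$; the numbers $\lambda_1<\lambda_2<\cdots$ are exactly the positive roots of this equation. Put $$\sigma(t)=\frac{p+t}{p-t},\qquad w_j=\frac{p^2+\lambda_j^2}{p\left(p+\frac1\pi\right)+\lambda_j^2},$$ and let $\zeta_p(s)=\sum_{j=1}^{\infty}w_j\lambda_j^{-s}$ for $\operatorname{Re}(s)>1$. Then this series has an analytic continuation $\zeta_p$ to $\mathbb{C}\setminus\{1\}$, and for every integer $m\ge 1$ and all real $\alpha,\beta>0$ with $\alpha\beta=\pi^2$, $$\alpha^{m+1}\left\{\frac12\zeta_p(-2m-1)+\sum_{j=1}^{\infty}\frac{w_j\,\lambda_j^{2m+1}}{\sigma\!\left(\frac{\lambda_j\alpha}{\pi}\right)e^{2\alpha\lambda_j}-1}\right\} =(-\beta)^{m+1}\left\{\frac12\zeta_p(-2m-1)+\sum_{j=1}^{\infty}\frac{w_j\,\lambda_j^{2m+1}}{\sigma\!\left(\frac{\lambda_j\beta}{\pi}\right)e^{2\beta\lambda_j}-1}\right\},$$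 where both series converge absolutely. (A summand in which $\sigma$ is evaluated at its pole $p$ is given its limiting value $0$.) -/

import Mathlib

noncomputable section

/-- `koshliakovRoot p k` is `λ_k`: for `p > 0` and `k ≥ 1`, the root of
`p sin(πx) + x cos(πx) = 0` in the interval `(k - 1/2, k)`. It exists and is unique there, and
these are all the positive roots; see the lemmas below. -/
def koshliakovRoot (p : ℝ) (k : ℕ) : ℝ :=
  Classical.epsilon fun x : ℝ =>
    (k : ℝ) - 1 / 2 < x ∧ x < k ∧
      p * Real.sin (Real.pi * x) + x * Real.cos (Real.pi * x) = 0

/-- The weight `w(x) = (p² + x²) / (p (p + 1/π) + x²)`. -/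
def koshliakovWeight (p x : ℝ) : ℝ :=
  (p ^ 2 + x ^ 2) / (p * (p + 1 / Real.pi) + x ^ 2)

/-- `σ(t) = (p + t) / (p - t)`. -/
def koshliakovSigma (p t : ℝ) : ℝ := (p + t) / (p - t)

/-- `Z` is an analytic continuation to `ℂ \ {1}` of the Dirichlet series
`ζ_p(s) = ∑_{j ≥ 1} w(λ_j) / λ_j ^ s`, which converges for `Re s > 1`. -/
def IsKoshliakovZeta (p : ℝ) (Z : ℂ → ℂ) : Prop :=
  DifferentiableOn ℂ Z {1}ᶜ ∧
    ∀ s : ℂ, 1 < s.re →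
      HasSum (fun j : ℕ =>
        (koshliakovWeight p (koshliakovRoot p (j + 1)) : ℂ) /
          (koshliakovRoot p (j + 1) : ℂ) ^ s) (Z s)

/-- The Koshliakov zeta function `ζ_p`, analytically continued to `ℂ \ {1}`. -/
def koshliakovZeta (p : ℝ) : ℂ → ℂ := Classical.epsilon (IsKoshliakovZeta p)

/-- The summand `w(λ) λ^(2m+1) / (σ(λ a / π) e^(2 a λ) - 1)`. The function `σ` has a pole at `p`;
when `λ a / π = p` the summand has its limiting value `0`. -/
def koshliakovTerm (p a : ℝ) (m : ℕ) (x : ℝ) : ℝ :=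
  if x * a / Real.pi = p then 0
  else koshliakovWeight p x *
    (x ^ (2 * m + 1) / (koshliakovSigma p (x * a / Real.pi) * Real.exp (2 * a * x) - 1))

end

theorem koshliakovRoot_spec {p : ℝ} (hp : 0 < p) {k : ℕ} (hk : 1 ≤ k) :
    (k : ℝ) - 1 / 2 < koshliakovRoot p k ∧ koshliakovRoot p k < k ∧
      p * Real.sin (Real.pi * koshliakovRoot p k) +
        koshliakovRoot p k * Real.cos (Real.pi * koshliakovRoot p k) = 0 := by
  have hk' : (1 : ℝ) ≤ k := by exact_mod_cast hk
  refine Classical.epsilon_spec (p := fun x : ℝ => (k : ℝ) - 1 / 2 < x ∧ x < k ∧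
      p * Real.sin (Real.pi * x) + x * Real.cos (Real.pi * x) = 0) ?_
  have hpi := Real.pi_pos
  -- substitute `x = k + y`
  have hshift : ∀ y : ℝ, p * Real.sin (Real.pi * (k + y)) +
      (k + y) * Real.cos (Real.pi * (k + y)) =
      (-1) ^ k * (p * Real.sin (Real.pi * y) + (k + y) * Real.cos (Real.pi * y)) := by
    intro y
    have e : Real.pi * (k + y) = Real.pi * y + k * Real.pi := by ring
    rw [e, Real.sin_add_nat_mul_pi, Real.cos_add_nat_mul_pi]; ring
  let g : ℝ → ℝ := fun y => p * Real.sin (Real.pi * y) + (k + y) * Real.cos (Real.pi * y)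
  have hg : Continuous g := by fun_prop
  have h1 : g (-(1 / 2)) < 0 := by
    have e : Real.pi * (-(1 / 2)) = -(Real.pi / 2) := by ring
    simp only [g, e, Real.sin_neg, Real.cos_neg, Real.sin_pi_div_two, Real.cos_pi_div_two]
    linarith
  have h2 : 0 < g 0 := by simp [g]; omega
  obtain ⟨y, ⟨hy1, hy2⟩, hy⟩ := intermediate_value_Ioo (by norm_num : (-(1 / 2) : ℝ) ≤ 0)
    hg.continuousOn ⟨h1, h2⟩
  refine ⟨k + y, by linarith, by linarith, ?_⟩
  rw [hshift]
  simp only [g] at hy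
  rw [hy, mul_zero]

theorem exists_eq_koshliakovRoot {p : ℝ} (hp : 0 < p) {x : ℝ} (hx : 0 < x)
    (h : p * Real.sin (Real.pi * x) + x * Real.cos (Real.pi * x) = 0) :
    ∃ k : ℕ, 1 ≤ k ∧ x = koshliakovRoot p k := by
  have hpi := Real.pi_pos
  -- `n` is the integer nearest to `x`
  obtain ⟨n, hn1, hn2⟩ : ∃ n : ℕ, (n : ℝ) - 1 / 2 ≤ x ∧ x < n + 1 / 2 := by
    refine ⟨⌊x + 1 / 2⌋₊, ?_, ?_⟩
    · have := Nat.floor_le (by linarith : 0 ≤ x + 1 / 2); linarith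
    · have := Nat.lt_floor_add_one (x + 1 / 2); linarith
  have hshift : ∀ y : ℝ, Real.sin (Real.pi * y) = (-1) ^ n * Real.sin (Real.pi * (y - n)) ∧
      Real.cos (Real.pi * y) = (-1) ^ n * Real.cos (Real.pi * (y - n)) := by
    intro y
    have e : Real.pi * y = Real.pi * (y - n) + n * Real.pi := by ring
    rw [e, Real.sin_add_nat_mul_pi, Real.cos_add_nat_mul_pi]
    simp
  have hsq : ((-1 : ℝ) ^ n) * (-1) ^ n = 1 := by
    rw [← mul_pow]; norm_num
  have hx0 : p * Real.sin (Real.pi * (x - n)) + x * Real.cos (Real.pi * (x - n)) = 0 := by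
    have h' := h
    rw [(hshift x).1, (hshift x).2] at h'
    linear_combination (-1) ^ n * h' -
      (p * Real.sin (Real.pi * (x - n)) + x * Real.cos (Real.pi * (x - n))) * hsq
  have hxn : x < n := by
    by_contra! hc
    have c : 0 < Real.cos (Real.pi * (x - n)) :=
      Real.cos_pos_of_mem_Ioo ⟨by nlinarith, by nlinarith⟩
    have s : 0 ≤ Real.sin (Real.pi * (x - n)) :=
      Real.sin_nonneg_of_nonneg_of_le_pi (by nlinarith) (by nlinarith)
    have := mul_pos hx c
    have := mul_nonneg hp.le s
    linarith
  have hn : 1 ≤ n := by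
    rcases Nat.eq_zero_or_pos n with h0 | h0
    · subst h0; simp at hxn; linarith
    · exact h0
  have hxl : (n : ℝ) - 1 / 2 < x := by
    refine lt_of_le_of_ne hn1 fun hc => ?_
    have e : Real.pi * (x - n) = -(Real.pi / 2) := by rw [← hc]; ring
    rw [e, Real.sin_neg, Real.cos_neg, Real.sin_pi_div_two, Real.cos_pi_div_two] at hx0
    linarith
  refine ⟨n, hn, ?_⟩
  obtain ⟨r1, r2, r3⟩ := koshliakovRoot_spec hp hn
  set y := koshliakovRoot p n
  have hy0 : p * Real.sin (Real.pi * (y - n)) + y * Real.cos (Real.pi * (y - n)) = 0 := by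
    have h' := r3
    rw [(hshift y).1, (hshift y).2] at h'
    linear_combination (-1) ^ n * h' -
      (p * Real.sin (Real.pi * (y - n)) + y * Real.cos (Real.pi * (y - n))) * hsq
  have cx : 0 < Real.cos (Real.pi * (x - n)) :=
    Real.cos_pos_of_mem_Ioo ⟨by nlinarith, by nlinarith⟩
  have cy : 0 < Real.cos (Real.pi * (y - n)) :=
    Real.cos_pos_of_mem_Ioo ⟨by nlinarith, by nlinarith⟩
  have key : p * Real.sin (Real.pi * (x - y)) +
      (x - y) * (Real.cos (Real.pi * (x - n)) * Real.cos (Real.pi * (y - n))) = 0 := by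
    have e : Real.pi * (x - y) = Real.pi * (x - n) - Real.pi * (y - n) := by ring
    rw [e, Real.sin_sub]
    linear_combination Real.cos (Real.pi * (y - n)) * hx0 - Real.cos (Real.pi * (x - n)) * hy0
  have cc := mul_pos cx cy
  rcases lt_trichotomy x y with hlt | heq | hgt
  · have s : Real.sin (Real.pi * (x - y)) < 0 :=
      Real.sin_neg_of_neg_of_neg_pi_lt (by nlinarith) (by nlinarith)
    have := mul_neg_of_pos_of_neg hp s
    have := mul_neg_of_neg_of_pos (sub_neg.2 hlt) cc
    linarith
  · exact heq
  · have s : 0 < Real.sin (Real.pi * (x - y)) :=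
      Real.sin_pos_of_pos_of_lt_pi (by nlinarith) (by nlinarith)
    have := mul_pos hp s
    have := mul_pos (sub_pos.2 hgt) cc
    linarith

/-- The analytic continuation is unique off the point `1`. -/
theorem IsKoshliakovZeta.eqOn {p : ℝ} {Z W : ℂ → ℂ} (hZ : IsKoshliakovZeta p Z)
    (hW : IsKoshliakovZeta p W) : Set.EqOn Z W {1}ᶜ := by
  have ho : IsOpen ({1}ᶜ : Set ℂ) := isOpen_compl_singleton
  refine (hZ.1.analyticOnNhd ho).eqOn_of_preconnected_of_eventuallyEq (hW.1.analyticOnNhd ho)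
    (isConnected_compl_singleton_of_one_lt_rank (by simp) 1).isPreconnected
    (z₀ := 2) (by simp) ?_
  have : {s : ℂ | 1 < s.re} ∈ nhds (2 : ℂ) :=
    (isOpen_lt continuous_const Complex.continuous_re).mem_nhds (by simp)
  filter_upwards [this] with s hs
  exact (hZ.2 s hs).unique (hW.2 s hs)

/-! Put ψ(z) = 1/(σ(z)e^{2πz} − 1) = num/(2 den) − 1/2. The zeros of `den` are 0 and ±iλ_j, all
simple, and the residue of num/(2 den) at iμ is w(μ)/(2π). Hence, for Re z > 0, πψ(z) + π/2 =
w(0)/(2z) + ∑ w_j z/(z² + λ_j²) (`hasSum_partialFractions`).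

Multiplying by e^{uz²} and integrating over a line Re z = c > 0 turns this into θ(u) = ∫ ψ(c+iy)
e^{u(c+iy)²} dy, where θ(u) = ∑ w_j e^{−uλ_j²} − ½√(π/u) + w(0)/2 (`theta_zero_eq_integral`). With c
= 1/u the right side is exponentially small as u → 0, so θ vanishes to infinite order at 0
(`abs_theta_zero_le`), and so do its derivatives. This flatness plays the part of a modular
relation.

The Laplace transform of θ at x² is (π/x)ψ(x) (`integral_exp_mul_theta`). So, with t = α/π, the
Lambert-type series is (t/π)∫ θ(u)Θ(t²u) du, where Θ(u) = ∑ w_j λ_j^{2m+2} e^{−uλ_j²}. Here Θ is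
θ_{m+1} = (−1)^{m+1}θ^{(m+1)} plus a multiple of u^{−m−3/2}. The power contributes Γ(m+3/2)M/(2π) ·
t^{−2m−2} with M = ∫ θ(u)u^{−m−3/2} du, while the Mellin continuation gives ζ_p(−2m−1) =
(−1)^{m+1}Γ(m+3/2)M/π (`koshliakovZeta_neg_odd`). After multiplication by the prefactors, the zeta
term of each side is therefore the power term of the other.

What remains is I(s) = ∫ θ(u)θ_{m+1}(su) du. Integrating by parts m+1 times, without boundary terms,
and rescaling gives I(s) = (−1/s)^{m+1} s^{−1} I(1/s) (`integral_theta_mul_swap`), which is the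
required symmetry with s = t². -/

open Filter Topology Set MeasureTheory

namespace Koshliakov

variable {p : ℝ}

/-- The root `λ_{j+1}`, indexed from `0`. -/
noncomputable def root (p : ℝ) (j : ℕ) : ℝ := koshliakovRoot p (j + 1)

/-- The characteristic equation `p sin(πμ) + μ cos(πμ) = 0`. -/
def CharEq (p μ : ℝ) : Prop := p * Real.sin (Real.pi * μ) + μ * Real.cos (Real.pi * μ) = 0

/-- `p sinh(πz) + z cosh(πz)`. -/
noncomputable def den (p : ℝ) (z : ℂ) : ℂ :=
  p * Complex.sinh (Real.pi * z) + z * Complex.cosh (Real.pi * z)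

/-- `p cosh(πz) + z sinh(πz)`. -/
noncomputable def num (p : ℝ) (z : ℂ) : ℂ :=
  p * Complex.cosh (Real.pi * z) + z * Complex.sinh (Real.pi * z)

/-! ### The roots and the weights -/

theorem lt_root (hp : 0 < p) (j : ℕ) : (j : ℝ) + 1 / 2 < root p j := by
  have := (koshliakovRoot_spec hp (Nat.le_add_left 1 j)).1
  push_cast at this
  unfold root
  linarith

theorem root_lt (hp : 0 < p) (j : ℕ) : root p j < j + 1 := by
  have := (koshliakovRoot_spec hp (Nat.le_add_left 1 j)).2.1
  push_cast at this
  exact this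

theorem charEq_root (hp : 0 < p) (j : ℕ) : CharEq p (root p j) :=
  (koshliakovRoot_spec hp (Nat.le_add_left 1 j)).2.2

theorem half_le_root (hp : 0 < p) (j : ℕ) : 1 / 2 ≤ root p j := by
  have := lt_root hp j
  have : (0 : ℝ) ≤ j := j.cast_nonneg
  linarith

theorem root_pos (hp : 0 < p) (j : ℕ) : 0 < root p j := by
  have := half_le_root hp j
  linarith

theorem root_strictMono (hp : 0 < p) : StrictMono (root p) := by
  refine strictMono_nat_of_lt_succ fun j => ?_
  have h1 := root_lt hp j
  have h2 := lt_root hp (j + 1)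
  push_cast at h2
  linarith

theorem charEq_zero : CharEq p 0 := by simp [CharEq]

theorem CharEq.neg {μ : ℝ} (h : CharEq p μ) : CharEq p (-μ) := by
  unfold CharEq at *
  rw [mul_neg, Real.sin_neg, Real.cos_neg]
  linarith

theorem CharEq.eq_root (hp : 0 < p) {μ : ℝ} (h : CharEq p μ) (hμ : 0 < μ) :
    ∃ j, μ = root p j := by
  obtain ⟨k, hk, rfl⟩ := exists_eq_koshliakovRoot hp hμ h
  exact ⟨k - 1, by rw [root, Nat.sub_add_cancel hk]⟩

/-- With d = j + 1 − λ the equation reads p sin πd = λ cos πd; insert sin πd ≤ πd, cos πd ≥ 1 − 2d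
and λ ≥ 1/2. The bound is uniform in j, so the poles stay away from integer heights. -/
theorem root_gap (hp : 0 < p) (j : ℕ) : 1 / (2 * (p * Real.pi + 1)) ≤ j + 1 - root p j := by
  have h1 := lt_root hp j
  have h2 := root_lt hp j
  have h4 := half_le_root hp j
  have h3 := charEq_root hp j
  have hpi := Real.pi_pos
  set d := (j : ℝ) + 1 - root p j with hd
  have e : Real.pi * root p j = -(Real.pi * d) + (j + 1 : ℕ) * Real.pi := by
    rw [hd]; push_cast; ring
  rw [CharEq, e, Real.sin_add_nat_mul_pi, Real.cos_add_nat_mul_pi, Real.sin_neg, Real.cos_neg] at h3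
  have h5 : p * Real.sin (Real.pi * d) = root p j * Real.cos (Real.pi * d) := by
    have : ((-1 : ℝ) ^ (j + 1)) ≠ 0 := by positivity
    apply mul_left_cancel₀ this
    linear_combination -h3
  have h6 : Real.sin (Real.pi * d) ≤ Real.pi * d := Real.sin_le (by nlinarith)
  -- Jordan's inequality for the complementary angle π/2 − πd.
  have h7 : 1 - 2 * d ≤ Real.cos (Real.pi * d) := by
    have := Real.mul_le_sin (x := Real.pi / 2 - Real.pi * d) (by nlinarith) (by nlinarith)
    rw [Real.sin_pi_div_two_sub] at this
    have e : 2 / Real.pi * (Real.pi / 2 - Real.pi * d) = 1 - 2 * d := by field_simp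
    linarith
  rw [div_le_iff₀ (by positivity)]
  have h8 := mul_le_mul_of_nonneg_left h6 hp.le
  have h9 := mul_le_mul_of_nonneg_left h7 (root_pos hp j).le
  have hd0 : 0 < d := by linarith
  have : root p j * 1 ≤ root p j * (2 * d * (p * Real.pi + 1)) := by
    have := mul_le_mul_of_nonneg_right h4 (by positivity : 0 ≤ p * Real.pi * d)
    nlinarith
  have := le_of_mul_le_mul_left this (root_pos hp j)
  linarith

theorem weight_pos (hp : 0 < p) (x : ℝ) : 0 < koshliakovWeight p x := by
  have := Real.pi_pos
  unfold koshliakovWeight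
  positivity

theorem weight_le_one (hp : 0 < p) (x : ℝ) : koshliakovWeight p x ≤ 1 := by
  have := Real.pi_pos
  unfold koshliakovWeight
  rw [div_le_one (by positivity)]
  have : 0 < p * (1 / Real.pi) := by positivity
  nlinarith

theorem weight_neg (x : ℝ) : koshliakovWeight p (-x) = koshliakovWeight p x := by
  simp [koshliakovWeight]

/-! ### The denominator and its zeros -/

theorem differentiable_den : Differentiable ℂ (den p) := by
  unfold den; fun_prop

theorem differentiable_num : Differentiable ℂ (num p) := by
  unfold num; fun_prop

theorem den_neg (z : ℂ) : den p (-z) = -den p z := by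
  simp only [den, mul_neg, Complex.sinh_neg, Complex.cosh_neg]; ring

theorem num_neg (z : ℂ) : num p (-z) = num p z := by
  simp only [num, mul_neg, Complex.sinh_neg, Complex.cosh_neg]; ring

theorem den_eq (z : ℂ) : den p z =
    ((p + z) * Complex.exp (Real.pi * z) - (p - z) * Complex.exp (-(Real.pi * z))) / 2 := by
  rw [den, Complex.sinh, Complex.cosh]; ring

theorem num_eq (z : ℂ) : num p z =
    ((p + z) * Complex.exp (Real.pi * z) + (p - z) * Complex.exp (-(Real.pi * z))) / 2 := by
  rw [num, Complex.sinh, Complex.cosh]; ring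

theorem norm_sub_le_norm_add (hp : 0 < p) {z : ℂ} (hz : 0 ≤ z.re) :
    ‖(p : ℂ) - z‖ ≤ ‖(p : ℂ) + z‖ := by
  rw [Complex.norm_def, Complex.norm_def]
  apply Real.sqrt_le_sqrt
  simp only [Complex.normSq_apply, Complex.sub_re, Complex.add_re, Complex.sub_im, Complex.add_im,
    Complex.ofReal_re, Complex.ofReal_im]
  nlinarith

theorem norm_add_pos (hp : 0 < p) {z : ℂ} (hz : 0 ≤ z.re) : 0 < ‖(p : ℂ) + z‖ := by
  rw [norm_pos_iff]
  intro h
  have := congrArg Complex.re h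
  simp at this
  linarith

theorem norm_exp_pi_mul (z : ℂ) : ‖Complex.exp (Real.pi * z)‖ = Real.exp (Real.pi * z.re) := by
  rw [Complex.norm_exp]; simp

theorem norm_exp_neg_pi_mul (z : ℂ) :
    ‖Complex.exp (-(Real.pi * z))‖ = Real.exp (-(Real.pi * z.re)) := by
  rw [Complex.norm_exp]; simp

/-- A zero means (p+z)e^{πz} = (p−z)e^{−πz}, but in the right half-plane both factors on the left
dominate in modulus, the exponential strictly. -/
theorem den_ne_zero_of_re_pos (hp : 0 < p) {z : ℂ} (hz : 0 < z.re) : den p z ≠ 0 := by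
  intro h
  rw [den_eq] at h
  have h1 : (p + z) * Complex.exp (Real.pi * z) = (p - z) * Complex.exp (-(Real.pi * z)) := by
    linear_combination 2 * h
  have h2 := congrArg norm h1
  rw [norm_mul, norm_mul, norm_exp_pi_mul, norm_exp_neg_pi_mul] at h2
  have h3 := norm_sub_le_norm_add hp hz.le
  have h4 := norm_add_pos hp hz.le
  have h5 : Real.exp (-(Real.pi * z.re)) < Real.exp (Real.pi * z.re) := by
    apply Real.exp_lt_exp.2
    have := mul_pos Real.pi_pos hz
    linarith
  have := mul_le_mul_of_nonneg_right h3 (Real.exp_pos (-(Real.pi * z.re))).le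
  nlinarith

theorem den_ofReal_mul_I (μ : ℝ) : den p (μ * Complex.I) =
    ((p * Real.sin (Real.pi * μ) + μ * Real.cos (Real.pi * μ) : ℝ) : ℂ) * Complex.I := by
  rw [den, ← mul_assoc, Complex.sinh_mul_I, Complex.cosh_mul_I]
  push_cast
  ring

theorem num_ofReal_mul_I (μ : ℝ) : num p (μ * Complex.I) =
    ((p * Real.cos (Real.pi * μ) - μ * Real.sin (Real.pi * μ) : ℝ) : ℂ) := by
  rw [num, ← mul_assoc, Complex.sinh_mul_I, Complex.cosh_mul_I]
  push_cast
  linear_combination μ * Complex.sin (Real.pi * μ) * Complex.I_sq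

theorem exists_charEq_of_den_eq_zero (hp : 0 < p) {z : ℂ} (h : den p z = 0) :
    ∃ μ : ℝ, z = μ * Complex.I ∧ CharEq p μ := by
  have hre : z.re = 0 := by
    rcases lt_trichotomy z.re 0 with h0 | h0 | h0
    · exact absurd (by rw [den_neg, h, neg_zero])
        (den_ne_zero_of_re_pos hp (z := -z) (by simpa using h0))
    · exact h0
    · exact absurd h (den_ne_zero_of_re_pos hp h0)
  have hz : z = z.im * Complex.I := by
    apply Complex.ext <;> simp [hre]
  refine ⟨z.im, hz, ?_⟩
  rw [hz, den_ofReal_mul_I] at h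
  have := (mul_eq_zero.1 h).resolve_right Complex.I_ne_zero
  exact_mod_cast this

theorem hasDerivAt_den (z : ℂ) : HasDerivAt (den p)
    ((p * Real.pi + 1) * Complex.cosh (Real.pi * z) + Real.pi * z * Complex.sinh (Real.pi * z))
    z := by
  have h0 : HasDerivAt (fun z : ℂ => (Real.pi : ℂ) * z) Real.pi z := by
    simpa using (hasDerivAt_id z).const_mul (Real.pi : ℂ)
  have h1 := (h0.csinh.const_mul (p : ℂ)).add ((hasDerivAt_id z).mul h0.ccosh)
  refine h1.congr_deriv ?_
  simp only [id]
  ring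

/-- The zero at iμ is simple, and the quotient is the residue of num/(2 den) there. Modulo the
characteristic equation, p·num and p·den' are cos(πμ) times p² + μ² and p(pπ+1) + πμ²; this is the
origin of the weight. -/
theorem CharEq.deriv_den_ne_zero (hp : 0 < p) {μ : ℝ} (h : CharEq p μ) :
    deriv (den p) (μ * Complex.I) ≠ 0 ∧
      num p (μ * Complex.I) / (2 * deriv (den p) (μ * Complex.I)) =
        koshliakovWeight p μ / (2 * Real.pi) := by
  have hpi := Real.pi_pos
  rw [(hasDerivAt_den _).deriv, num_ofReal_mul_I, ← mul_assoc, Complex.sinh_mul_I,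
    Complex.cosh_mul_I]
  unfold CharEq at h
  set s := Real.sin (Real.pi * μ) with hs
  set c := Real.cos (Real.pi * μ) with hc
  have e : ((p : ℂ) * Real.pi + 1) * Complex.cos (Real.pi * μ) +
      Real.pi * μ * Complex.I * Complex.sin (Real.pi * μ) * Complex.I =
      (((p * Real.pi + 1) * c - Real.pi * μ * s : ℝ) : ℂ) := by
    rw [hs, hc]
    push_cast
    linear_combination Real.pi * μ * Complex.sin (Real.pi * μ) * Complex.I_sq
  simp only [← mul_assoc]
  rw [e]
  have hsq : s ^ 2 + c ^ 2 = 1 := Real.sin_sq_add_cos_sq _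
  have hc0 : c ≠ 0 := by
    intro h0
    rw [h0] at h hsq
    have : s = 0 := by
      have : p * s = 0 := by linarith
      exact (mul_eq_zero.1 this).resolve_left hp.ne'
    rw [this] at hsq
    norm_num at hsq
  have hpos : 0 < p * (p * Real.pi + 1) + Real.pi * μ ^ 2 := by positivity
  have e1 : p * ((p * Real.pi + 1) * c - Real.pi * μ * s) =
      c * (p * (p * Real.pi + 1) + Real.pi * μ ^ 2) := by
    linear_combination -Real.pi * μ * h
  have e2 : p * (p * c - μ * s) = c * (p ^ 2 + μ ^ 2) := by
    linear_combination -μ * h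
  have h1 : (p * Real.pi + 1) * c - Real.pi * μ * s ≠ 0 := by
    intro h0
    rw [h0, mul_zero] at e1
    exact mul_ne_zero hc0 hpos.ne' e1.symm
  refine ⟨by exact_mod_cast h1, ?_⟩
  have : (p * c - μ * s) / (2 * ((p * Real.pi + 1) * c - Real.pi * μ * s)) =
      koshliakovWeight p μ / (2 * Real.pi) := by
    have h2 : p * (p + 1 / Real.pi) + μ ^ 2 ≠ 0 := by positivity
    have h3 : koshliakovWeight p μ * (p * (p * Real.pi + 1) + Real.pi * μ ^ 2) =
        Real.pi * (p ^ 2 + μ ^ 2) := by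
      rw [koshliakovWeight]; field_simp
    rw [div_eq_div_iff (by simpa using h1) (by positivity)]
    apply mul_left_cancel₀ hp.ne'
    linear_combination 2 * Real.pi * e2 - 2 * koshliakovWeight p μ * e1 - 2 * c * h3
  exact_mod_cast this

/-! ### Removing the poles -/

/-- Taking the punctured limit of F at every point repairs all removable singularities at once: near
z it agrees with the local germ g, including at z itself. -/
theorem exists_analyticAt_extension {F : ℂ → ℂ} {U : Set ℂ}
    (h : ∀ z ∈ U, ∃ g : ℂ → ℂ, AnalyticAt ℂ g z ∧ F =ᶠ[𝓝[≠] z] g) :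
    ∃ E : ℂ → ℂ, (∀ z ∈ U, AnalyticAt ℂ E z) ∧ ∀ z, ContinuousAt F z → E z = F z := by
  refine ⟨fun z => limUnder (𝓝[≠] z) F, fun z hz => ?_, fun z hz => ?_⟩
  · obtain ⟨g, hg, hFg⟩ := h z hz
    refine hg.congr ?_
    have h1 : ∀ᶠ w in 𝓝[≠] z, F =ᶠ[𝓝 w] g := by
      have := eventually_eventually_nhdsWithin.2 hFg
      filter_upwards [this, self_mem_nhdsWithin] with w hw hwz
      rwa [isOpen_compl_singleton.nhdsWithin_eq hwz] at hw
    have h2 : ∀ᶠ w in 𝓝 z, AnalyticAt ℂ g w := hg.eventually_analyticAt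
    have h3 := eventually_nhdsWithin_iff.1 h1
    filter_upwards [h2, h3] with w hw1 hw2
    have : F =ᶠ[𝓝[≠] w] g := by
      by_cases hwz : w = z
      · rw [hwz]; exact hFg
      · exact (hw2 hwz).filter_mono nhdsWithin_le_nhds
    exact ((hw1.continuousAt.tendsto.mono_left nhdsWithin_le_nhds).congr' this.symm).limUnder_eq.symm
  · exact (hz.tendsto.mono_left nhdsWithin_le_nhds).limUnder_eq

/-- `num / (2 den)` minus its principal parts at the points `iμ`, `μ ∈ S`. -/
noncomputable def deflated (p : ℝ) (S : Finset ℝ) (z : ℂ) : ℂ :=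
  num p z / (2 * den p z) -
    ∑ μ ∈ S, (koshliakovWeight p μ / (2 * Real.pi) : ℂ) / (z - μ * Complex.I)

theorem analyticAt_principalParts {S : Finset ℝ} {z : ℂ} (hz : ∀ μ ∈ S, z ≠ μ * Complex.I) :
    AnalyticAt ℂ (fun z : ℂ =>
      ∑ μ ∈ S, (koshliakovWeight p μ / (2 * Real.pi) : ℂ) / (z - μ * Complex.I)) z := by
  refine Finset.analyticAt_fun_sum _ fun μ hμ => ?_
  exact analyticAt_const.div (analyticAt_id.sub analyticAt_const) (sub_ne_zero.2 (hz μ hμ))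

theorem analyticAt_deflated {S : Finset ℝ} (hS : ∀ μ ∈ S, CharEq p μ) {z : ℂ}
    (hz : den p z ≠ 0) : AnalyticAt ℂ (deflated p S) z := by
  refine AnalyticAt.sub ?_ (analyticAt_principalParts ?_)
  · exact (differentiable_num.analyticAt z).div
      (analyticAt_const.mul (differentiable_den.analyticAt z)) (by simpa using hz)
  · rintro μ hμ rfl
    apply hz
    rw [den_ofReal_mul_I, hS μ hμ]
    simp

/-- Factor den = (z − a)q with q(a) = den'(a) ≠ 0. Then num/(2 den) = h/(z − a) with h = num/(2q),
and removing the principal part h(a)/(z − a) leaves the divided difference of h, which is analytic.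
-/
theorem exists_analyticAt_eq_deflated (hp : 0 < p) {S : Finset ℝ} (hS : ∀ μ ∈ S, CharEq p μ)
    {μ : ℝ} (hμ : μ ∈ S) :
    ∃ g : ℂ → ℂ, AnalyticAt ℂ g (μ * Complex.I) ∧
      deflated p S =ᶠ[𝓝[≠] (μ * Complex.I)] g := by
  obtain ⟨hd, hw⟩ := (hS μ hμ).deriv_den_ne_zero hp
  set a : ℂ := μ * Complex.I with ha
  have hda : den p a = 0 := by rw [ha, den_ofReal_mul_I, hS μ hμ]; simp
  set q := dslope (den p) a with hq
  have hqd : Differentiable ℂ q := by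
    rw [← differentiableOn_univ]
    exact (Complex.differentiableOn_dslope univ_mem).2 differentiable_den.differentiableOn
  have hqa : q a ≠ 0 := by rwa [hq, dslope_same]
  set h : ℂ → ℂ := fun z => num p z / (2 * q z) with hh
  have hha : h a = koshliakovWeight p μ / (2 * Real.pi) := by
    rw [hh]; simp only; rw [hq, dslope_same, hw]
  have hU : {z | q z ≠ 0} ∈ 𝓝 a := (hqd.continuous.continuousAt).eventually_ne hqa
  have hhd : DifferentiableOn ℂ h {z | q z ≠ 0} := by
    intro z hz
    exact ((differentiable_num z).div ((differentiableAt_const _).mul (hqd z))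
      (by simpa using hz)).differentiableWithinAt
  have hslope : AnalyticAt ℂ (dslope h a) a :=
    ((Complex.differentiableOn_dslope hU).2 hhd).analyticAt hU
  refine ⟨fun z => dslope h a z - ∑ ν ∈ S.erase μ,
    (koshliakovWeight p ν / (2 * Real.pi) : ℂ) / (z - ν * Complex.I), ?_, ?_⟩
  · refine hslope.sub (analyticAt_principalParts fun ν hν e => ?_)
    rw [ha] at e
    have := mul_right_cancel₀ Complex.I_ne_zero e
    exact (Finset.ne_of_mem_erase hν) (by exact_mod_cast this.symm)
  · filter_upwards [self_mem_nhdsWithin] with z hz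
    have hz0 : z - a ≠ 0 := sub_ne_zero.2 hz
    rw [deflated, ← Finset.add_sum_erase _ _ hμ, ← ha, ← hha, dslope_of_ne _ hz, slope_def_field]
    have hdz : den p z = (z - a) * q z := by
      rw [hq, ← smul_eq_mul, sub_smul_dslope, hda, sub_zero]
    rw [hdz]
    have : num p z / (2 * ((z - a) * q z)) = h z / (z - a) := by
      simp only [hh]
      rw [div_div]
      ring
    rw [this]
    ring

/-- The poles of `num / (2 den)` on the imaginary axis of height less than `N`, divided by `i`. -/
noncomputable def poleSet (p : ℝ) (N : ℕ) : Finset ℝ :=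
  insert 0 ((Finset.range N).image (root p) ∪ (Finset.range N).image fun j => -root p j)

theorem charEq_of_mem_poleSet (hp : 0 < p) {N : ℕ} {μ : ℝ} (hμ : μ ∈ poleSet p N) :
    CharEq p μ := by
  simp only [poleSet, Finset.mem_insert, Finset.mem_union, Finset.mem_image] at hμ
  rcases hμ with rfl | ⟨j, -, rfl⟩ | ⟨j, -, rfl⟩
  · exact charEq_zero
  · exact charEq_root hp j
  · exact (charEq_root hp j).neg

theorem mem_poleSet (hp : 0 < p) {N : ℕ} {μ : ℝ} (h : CharEq p μ) (hN : |μ| ≤ N) :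
    μ ∈ poleSet p N := by
  have key : ∀ ν : ℝ, CharEq p ν → 0 < ν → ν ≤ N → ∃ j < N, root p j = ν := by
    intro ν hν h0 hνN
    obtain ⟨j, rfl⟩ := hν.eq_root hp h0
    refine ⟨j, ?_, rfl⟩
    have := lt_root hp j
    have : (j : ℝ) < N := by linarith
    exact_mod_cast this
  simp only [poleSet, Finset.mem_insert, Finset.mem_union, Finset.mem_image, Finset.mem_range]
  rcases lt_trichotomy μ 0 with h0 | h0 | h0
  · obtain ⟨j, hj, e⟩ := key (-μ) h.neg (by linarith) ((neg_le_abs μ).trans hN)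
    exact Or.inr (Or.inr ⟨j, hj, by linarith⟩)
  · exact Or.inl h0
  · exact Or.inr (Or.inl (key μ h h0 ((le_abs_self μ).trans hN)))

theorem sum_poleSet (hp : 0 < p) (N : ℕ) (f : ℝ → ℂ) :
    ∑ μ ∈ poleSet p N, f μ = f 0 + ∑ j ∈ Finset.range N, (f (root p j) + f (-root p j)) := by
  have hinj := (root_strictMono hp).injective
  rw [poleSet, Finset.sum_insert, Finset.sum_union, Finset.sum_image, Finset.sum_image,
    Finset.sum_add_distrib]
  · intro a _ b _ h
    exact hinj (neg_injective h)
  · intro a _ b _ h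
    exact hinj h
  · rw [Finset.disjoint_left]
    simp only [Finset.mem_image, not_exists, not_and]
    rintro _ ⟨i, -, rfl⟩ j - h
    have := root_pos hp i
    have := root_pos hp j
    linarith
  · simp only [Finset.mem_union, Finset.mem_image, not_or, not_exists, not_and]
    exact ⟨fun j _ => (root_pos hp j).ne', fun j _ => (neg_neg_of_pos (root_pos hp j)).ne⟩

theorem sq_add_sq_ne_zero {z : ℂ} (hz : den p z ≠ 0) {μ : ℝ} (hμ : CharEq p μ) :
    z ^ 2 + (μ : ℂ) ^ 2 ≠ 0 := by
  have key : ∀ ν : ℝ, CharEq p ν → z - ν * Complex.I ≠ 0 := by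
    intro ν hν h
    apply hz
    rw [sub_eq_zero.1 h, den_ofReal_mul_I, hν]
    simp
  have e : z ^ 2 + (μ : ℂ) ^ 2 = (z - μ * Complex.I) * (z - (-μ : ℝ) * Complex.I) := by
    push_cast
    linear_combination (μ : ℂ) ^ 2 * Complex.I_sq
  rw [e]
  exact mul_ne_zero (key μ hμ) (key (-μ) hμ.neg)

theorem deflated_eq (hp : 0 < p) (N : ℕ) {z : ℂ} (hz : den p z ≠ 0) :
    deflated p (poleSet p N) z = num p z / (2 * den p z) - koshliakovWeight p 0 / (2 * Real.pi * z)
      - ∑ j ∈ Finset.range N,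
        koshliakovWeight p (root p j) / Real.pi * (z / (z ^ 2 + (root p j : ℂ) ^ 2)) := by
  rw [deflated, sum_poleSet hp, sub_sub]
  congr 2
  · simp [div_div]
  · refine Finset.sum_congr rfl fun j _ => ?_
    have h := sq_add_sq_ne_zero hz (charEq_root hp j)
    have e : z ^ 2 + (root p j : ℂ) ^ 2 =
        (z - root p j * Complex.I) * (z + root p j * Complex.I) := by
      linear_combination (root p j : ℂ) ^ 2 * Complex.I_sq
    rw [weight_neg, e]
    rw [e] at h
    have h1 := left_ne_zero_of_mul h
    have h2 := right_ne_zero_of_mul h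
    have hpi : (Real.pi : ℂ) ≠ 0 := by exact_mod_cast Real.pi_ne_zero
    have e3 : z - (-root p j : ℝ) * Complex.I = z + root p j * Complex.I := by
      push_cast; ring
    rw [e3]
    field_simp
    ring

/-- Oddness is needed to make the pole-free extension vanish at 0, so that it can be divided by z.
-/
theorem deflated_neg (hp : 0 < p) (N : ℕ) {z : ℂ} (hz : den p z ≠ 0) :
    deflated p (poleSet p N) (-z) = -deflated p (poleSet p N) z := by
  have hz' : den p (-z) ≠ 0 := by rwa [den_neg, neg_ne_zero]
  rw [deflated_eq hp N hz, deflated_eq hp N hz', num_neg, den_neg]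
  simp only [neg_sq, neg_div, mul_neg, div_neg, Finset.sum_neg_distrib]
  ring

/-! ### Bounds on squares of half-side N and the vanishing of the remainder -/

theorem norm_sub_mul_I_ge {z : ℂ} {N μ : ℝ} (hz : |z.re| = N ∨ |z.im| = N) :
    N - |μ| ≤ ‖z - μ * Complex.I‖ := by
  rcases hz with h | h
  · have := Complex.abs_re_le_norm (z - μ * Complex.I)
    simp at this
    have := abs_nonneg μ
    linarith
  · have h1 := Complex.abs_im_le_norm (z - μ * Complex.I)
    have h2 := abs_sub_abs_le_abs_sub z.im μ
    simp at h1
    linarith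

/-- The quotient is (A+B)/(2(A−B)) with A = (p+z)e^{πz} and B = (p−z)e^{−πz}; once 3‖B‖ ≤ ‖A‖ its
modulus is at most (4/3)/(2·2/3) = 1. -/
theorem norm_quot_le_of_re (hp : 0 < p) {z : ℂ} (hz : 1 ≤ |z.re|) :
    ‖num p z / (2 * den p z)‖ ≤ 1 := by
  wlog h : 0 ≤ z.re generalizing z
  · have := this (z := -z) (by simpa using hz) (by simp; linarith)
    rwa [num_neg, den_neg, mul_neg, div_neg, norm_neg] at this
  rw [abs_of_nonneg h] at hz
  have hd : den p z ≠ 0 := den_ne_zero_of_re_pos hp (by linarith)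
  rw [norm_div, div_le_one (norm_pos_iff.2 (mul_ne_zero two_ne_zero hd)), norm_mul, num_eq, den_eq]
  have h1 := norm_sub_le_norm_add hp h
  set A := (p + z) * Complex.exp (Real.pi * z) with hA
  set B := (p - z) * Complex.exp (-(Real.pi * z)) with hB
  have h2 : 3 * ‖B‖ ≤ ‖A‖ := by
    rw [hA, hB, norm_mul, norm_mul, norm_exp_pi_mul, norm_exp_neg_pi_mul]
    have h3 : 3 * Real.exp (-(Real.pi * z.re)) ≤ Real.exp (Real.pi * z.re) := by
      have h4 : 2 * (Real.pi * z.re) + 1 ≤ Real.exp (2 * (Real.pi * z.re)) := Real.add_one_le_exp _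
      have h5 : 3 ≤ Real.exp (2 * (Real.pi * z.re)) := by
        nlinarith [Real.pi_gt_three]
      have h6 : Real.exp (Real.pi * z.re) =
          Real.exp (2 * (Real.pi * z.re)) * Real.exp (-(Real.pi * z.re)) := by
        rw [← Real.exp_add]; ring_nf
      rw [h6]
      exact mul_le_mul_of_nonneg_right h5 (Real.exp_pos _).le
    have := mul_le_mul h1 h3 (by positivity) (norm_nonneg _)
    linarith
  have h3 : ‖(A + B) / 2‖ ≤ (‖A‖ + ‖B‖) / 2 := by
    rw [norm_div, Complex.norm_ofNat]; gcongr; exact norm_add_le A B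
  have h4 : (‖A‖ - ‖B‖) / 2 ≤ ‖(A - B) / 2‖ := by
    rw [norm_div, Complex.norm_ofNat]; gcongr; exact norm_sub_norm_le A B
  have : ‖(2 : ℂ)‖ = 2 := by simp
  rw [this]
  linarith

/-- At integer height the hyperbolic functions take, up to a common sign, their real values at x =
Re z. So up to sign `den` has imaginary part N cosh πx, while |num| ≤ (p + 2N) cosh πx. -/
theorem norm_quot_le_of_im (hp : 0 < p) {z : ℂ} {N : ℕ} (hN : 1 ≤ N) (hz : |z.im| = N)
    (hre : |z.re| ≤ N) : ‖num p z / (2 * den p z)‖ ≤ p + 1 := by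
  wlog h : 0 ≤ z.im generalizing z
  · have := this (z := -z) (by simpa using hz) (by simpa using hre) (by simp; linarith)
    rwa [num_neg, den_neg, mul_neg, div_neg, norm_neg] at this
  rw [abs_of_nonneg h] at hz
  have hN' : (1 : ℝ) ≤ N := by exact_mod_cast hN
  obtain ⟨x, hx⟩ : ∃ x : ℝ, x = z.re := ⟨_, rfl⟩
  have hzx : z = x + N * Complex.I := by
    apply Complex.ext <;> simp [hx, hz]
  have e : (Real.pi : ℂ) * z = (Real.pi * x : ℝ) + (N : ℝ) * Real.pi * Complex.I := by
    rw [hzx]; push_cast; ring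
  have hs : Complex.sin ((N : ℝ) * Real.pi) = 0 := by
    have := Complex.sin_nat_mul_pi N
    exact_mod_cast this
  have hc : Complex.cos ((N : ℝ) * Real.pi) = (-1) ^ N := by
    have := Real.cos_nat_mul_pi N
    exact_mod_cast congrArg ((↑) : ℝ → ℂ) this
  set S := Real.sinh (Real.pi * x) with hS
  set C := Real.cosh (Real.pi * x) with hC
  have esinh : Complex.sinh (Real.pi * z) = (-1) ^ N * S := by
    rw [e, Complex.sinh_add, Complex.sinh_mul_I, Complex.cosh_mul_I, hs, hc, hS]
    push_cast; ring
  have ecosh : Complex.cosh (Real.pi * z) = (-1) ^ N * C := by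
    rw [e, Complex.cosh_add, Complex.sinh_mul_I, Complex.cosh_mul_I, hs, hc, hC]
    push_cast; ring
  have hCpos : 0 < C := Real.cosh_pos _
  have hSC : |S| ≤ C := by
    rw [hS, Real.abs_sinh, hC, ← Real.cosh_abs]
    exact (Real.sinh_lt_cosh _).le
  have hn : ‖num p z‖ ≤ (p + 2 * N) * C := by
    have : num p z = (-1) ^ N * (p * C + z * S) := by
      rw [num, esinh, ecosh]; ring
    rw [this, norm_mul, norm_pow, norm_neg, norm_one, one_pow, one_mul]
    refine (norm_add_le _ _).trans ?_
    rw [norm_mul, norm_mul, Complex.norm_real, Complex.norm_real, Complex.norm_real,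
      Real.norm_of_nonneg hp.le, Real.norm_of_nonneg hCpos.le, Real.norm_eq_abs]
    have hz2 : ‖z‖ ≤ 2 * N := by
      have := Complex.norm_le_abs_re_add_abs_im z
      rw [hz, abs_of_nonneg (by positivity : (0 : ℝ) ≤ N)] at this
      linarith
    have := mul_le_mul hz2 hSC (abs_nonneg _) (by positivity)
    linarith
  have hd : N * C ≤ ‖den p z‖ := by
    have : den p z = (-1) ^ N * ((p * S + x * C : ℝ) + (N * C : ℝ) * Complex.I) := by
      rw [den, esinh, ecosh, hzx]; push_cast; ring
    rw [this, norm_mul, norm_pow, norm_neg, norm_one, one_pow, one_mul]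
    refine le_trans ?_ (Complex.abs_im_le_norm _)
    simp [abs_of_pos hCpos]
  have hNC : 0 < N * C := by positivity
  rw [norm_div, norm_mul]
  have : ‖(2 : ℂ)‖ = 2 := by simp
  rw [this, div_le_iff₀ (by linarith)]
  have h1 : (p + 2 * N) * C ≤ (p + 1) * (2 * (N * C)) := by
    have : p + 2 * N ≤ (p + 1) * (2 * N) := by nlinarith
    nlinarith
  have h2 := mul_le_mul_of_nonneg_left hd (by positivity : 0 ≤ (p + 1) * 2)
  linarith

/-- The quotient is bounded on the boundary of the square, and the principal parts add up to a
harmonic sum because the poles keep a uniform distance from height N. Growth is thus logarithmic in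
N. -/
theorem norm_deflated_le (hp : 0 < p) {z : ℂ} {N : ℕ} (hN : 1 ≤ N) (hre : |z.re| ≤ N)
    (hz : |z.re| = N ∨ |z.im| = N) :
    ‖deflated p (poleSet p N) z‖ ≤
      p + 2 + 2 * (2 * (p * Real.pi + 1)) * ∑ j ∈ Finset.range N, 1 / ((j : ℝ) + 1) := by
  have hN' : (1 : ℝ) ≤ N := by exact_mod_cast hN
  have hpi := Real.pi_pos
  have hG : ‖num p z / (2 * den p z)‖ ≤ p + 1 := by
    rcases hz with h | h
    · exact (norm_quot_le_of_re hp (h ▸ hN')).trans (by linarith)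
    · exact norm_quot_le_of_im hp hN h hre
  set g := 2 * (p * Real.pi + 1) with hg
  have hg1 : 1 ≤ g := by nlinarith [mul_pos hp hpi]
  have hterm : ∀ μ : ℝ, |μ| < N →
      ‖(koshliakovWeight p μ / (2 * Real.pi) : ℂ) / (z - μ * Complex.I)‖ ≤ 1 / (N - |μ|) := by
    intro μ hμ
    have h1 := norm_sub_mul_I_ge (μ := μ) hz
    rw [norm_div]
    apply div_le_div₀ zero_le_one _ (by linarith) h1
    have : (koshliakovWeight p μ / (2 * Real.pi) : ℂ) = (koshliakovWeight p μ / (2 * Real.pi) : ℝ) := by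
      push_cast; rfl
    rw [this, Complex.norm_real, Real.norm_of_nonneg (by have := weight_pos hp μ; positivity),
      div_le_one (by positivity)]
    have := weight_le_one hp μ
    linarith [Real.pi_gt_three]
  have hj : ∀ j ∈ Finset.range N, 1 / (N - root p j) ≤ g * (1 / ((N - 1 - j : ℕ) + 1 : ℝ)) := by
    intro j hj
    have hjN := Finset.mem_range.1 hj
    have e : ((N - 1 - j : ℕ) : ℝ) + 1 = N - j := by
      have : N - 1 - j + 1 + j = N := by omega
      have : ((N - 1 - j : ℕ) : ℝ) + 1 + j = N := by exact_mod_cast this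
      linarith
    have hjN' : (j : ℝ) + 1 ≤ N := by exact_mod_cast hjN
    have h1 := root_gap hp j
    rw [e]
    -- N − λ_j = (N − j − 1) + (j + 1 − λ_j) ≥ (N − j − 1) + 1/g, and g ≥ 1.
    have h2 : (N - j : ℝ) / g ≤ N - root p j := by
      rw [div_le_iff₀ (by linarith)]
      rw [← hg, div_le_iff₀ (by linarith)] at h1
      nlinarith
    have h3 : 0 < (N - j : ℝ) / g := div_pos (by linarith) (by linarith)
    calc 1 / (N - root p j) ≤ 1 / ((N - j : ℝ) / g) := one_div_le_one_div_of_le h3 h2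
      _ = g * (1 / (N - j : ℝ)) := by field_simp
  have hlt : ∀ j ∈ Finset.range N, |root p j| < N := by
    intro j hj
    rw [abs_of_pos (root_pos hp j)]
    have h1 := root_lt hp j
    have : (j : ℝ) + 1 ≤ N := by exact_mod_cast Finset.mem_range.1 hj
    linarith
  rw [deflated, sum_poleSet hp]
  refine (norm_sub_le _ _).trans ?_
  have h0 := hterm 0 (by simp; omega)
  have h0' : 1 / ((N : ℝ) - |0|) ≤ 1 := by
    rw [abs_zero, sub_zero, div_le_one (by linarith)]; exact hN'
  have hsum : ‖∑ j ∈ Finset.range N,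
      ((koshliakovWeight p (root p j) / (2 * Real.pi) : ℂ) / (z - root p j * Complex.I) +
      (koshliakovWeight p (-root p j) / (2 * Real.pi) : ℂ) / (z - (-root p j : ℝ) * Complex.I))‖ ≤
      2 * g * ∑ j ∈ Finset.range N, 1 / ((j : ℝ) + 1) := by
    rw [← Finset.sum_range_reflect (fun j : ℕ => 1 / ((j : ℝ) + 1)), Finset.mul_sum]
    refine norm_sum_le_of_le _ fun j hjN => ?_
    have h1 := hterm (root p j) (hlt j hjN)
    have h2 := hterm (-root p j) (by rw [abs_neg]; exact hlt j hjN)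
    rw [abs_neg] at h2
    rw [abs_of_pos (root_pos hp j)] at h1 h2
    have h3 := hj j hjN
    refine (norm_add_le _ _).trans ?_
    linarith
  have := norm_add_le ((koshliakovWeight p 0 / (2 * Real.pi) : ℂ) / (z - (0 : ℝ) * Complex.I))
    (∑ j ∈ Finset.range N,
      ((koshliakovWeight p (root p j) / (2 * Real.pi) : ℂ) / (z - root p j * Complex.I) +
      (koshliakovWeight p (-root p j) / (2 * Real.pi) : ℂ) / (z - (-root p j : ℝ) * Complex.I)))
  linarith

/-- All poles of height at most N have been subtracted. The extension is odd along the real axis off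
0, so its two one-sided limits at 0 are opposite and the value there is 0. -/
theorem exists_odd_extension_deflated (hp : 0 < p) (N : ℕ) :
    ∃ E : ℂ → ℂ, (∀ z : ℂ, |z.im| ≤ N → AnalyticAt ℂ E z) ∧ E 0 = 0 ∧
      ∀ z, den p z ≠ 0 → E z = deflated p (poleSet p N) z := by
  have hS : ∀ μ ∈ poleSet p N, CharEq p μ := fun μ hμ => charEq_of_mem_poleSet hp hμ
  obtain ⟨E, hE, hEF⟩ := exists_analyticAt_extension (F := deflated p (poleSet p N))
    (U := {z | |z.im| ≤ N}) (by
      intro z hz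
      by_cases hd : den p z = 0
      · obtain ⟨μ, rfl, hμ⟩ := exists_charEq_of_den_eq_zero hp hd
        exact exists_analyticAt_eq_deflated hp hS (mem_poleSet hp hμ (by simpa using hz))
      · exact ⟨_, analyticAt_deflated hS hd, EventuallyEq.rfl⟩)
  have hEd : ∀ z, den p z ≠ 0 → E z = deflated p (poleSet p N) z := fun z hz =>
    hEF z (analyticAt_deflated hS hz).continuousAt
  refine ⟨E, hE, ?_, hEd⟩
  have hc : ContinuousAt E 0 := (hE 0 (by simp)).continuousAt
  have h1 : Tendsto (fun x : ℝ => E x) (𝓝[>] 0) (𝓝 (E 0)) := by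
    have : ContinuousAt (fun x : ℝ => E x) 0 :=
      ContinuousAt.comp (by simpa using hc) Complex.continuous_ofReal.continuousAt
    simpa using this.tendsto.mono_left nhdsWithin_le_nhds
  have h2 : Tendsto (fun x : ℝ => E (-x : ℂ)) (𝓝[>] 0) (𝓝 (E 0)) := by
    have : ContinuousAt (fun x : ℝ => E (-x : ℂ)) 0 :=
      ContinuousAt.comp (g := E) (by simpa using hc) Complex.continuous_ofReal.neg.continuousAt
    simpa using this.tendsto.mono_left nhdsWithin_le_nhds
  have h3 : Tendsto (fun x : ℝ => E (-x : ℂ)) (𝓝[>] 0) (𝓝 (-E 0)) := by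
    refine h1.neg.congr' ?_
    filter_upwards [self_mem_nhdsWithin] with x hx
    have hd : den p x ≠ 0 := den_ne_zero_of_re_pos hp (by simpa using hx)
    rw [hEd _ hd, hEd _ (by rwa [den_neg, neg_ne_zero]), deflated_neg hp N hd]
  have := tendsto_nhds_unique h2 h3
  exact self_eq_neg.1 this

/-- Maximum modulus for E(z)/z on the square: dividing by z gains a factor 1/N on the boundary,
which beats the logarithmic growth of E. -/
theorem norm_deflated_le_mul (hp : 0 < p) {z : ℂ} (hz : den p z ≠ 0) {N : ℕ} (hN : 1 ≤ N)
    (hre : |z.re| < N) (him : |z.im| < N) :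
    ‖deflated p (poleSet p N) z‖ ≤ ‖z‖ *
      ((p + 2) * (N : ℝ)⁻¹ + 2 * (2 * (p * Real.pi + 1)) *
        ((N : ℝ)⁻¹ * ∑ j ∈ Finset.range N, 1 / ((j : ℝ) + 1))) := by
  obtain ⟨E, hE, hE0, hEd⟩ := exists_odd_extension_deflated hp N
  have hN' : (0 : ℝ) < N := by exact_mod_cast hN
  set R : Set ℂ := Ioo (-N : ℝ) N ×ℂ Ioo (-N : ℝ) N with hR
  have hRo : IsOpen R := isOpen_Ioo.reProdIm isOpen_Ioo
  have hcl : closure R = Icc (-N : ℝ) N ×ℂ Icc (-N : ℝ) N := by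
    rw [hR, Complex.closure_reProdIm, closure_Ioo (by linarith)]
  have hdiff : ∀ w ∈ closure R, AnalyticAt ℂ E w := by
    intro w hw
    rw [hcl] at hw
    exact hE w (abs_le.2 hw.2)
  have h0R : (0 : ℂ) ∈ R := by simp [hR, Complex.mem_reProdIm, hN']
  have hdR : DifferentiableOn ℂ E R := fun w hw =>
    (hdiff w (subset_closure hw)).differentiableAt.differentiableWithinAt
  have hds : DiffContOnCl ℂ (dslope E 0) R := by
    refine ⟨(Complex.differentiableOn_dslope (hRo.mem_nhds h0R)).2 hdR, ?_⟩
    intro w hw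
    by_cases hw0 : w = 0
    · rw [hw0]
      exact (continuousAt_dslope_same.2 (hdiff 0 (subset_closure h0R)).differentiableAt)
        |>.continuousWithinAt
    · exact ((continuousAt_dslope_of_ne hw0).2 (hdiff w hw).continuousAt).continuousWithinAt
  have hb : Bornology.IsBounded R :=
    (Metric.isBounded_Ioo _ _).reProdIm (Metric.isBounded_Ioo _ _)
  have hfr : ∀ w ∈ frontier R, ‖dslope E 0 w‖ ≤ (p + 2) * (N : ℝ)⁻¹ +
      2 * (2 * (p * Real.pi + 1)) * ((N : ℝ)⁻¹ * ∑ j ∈ Finset.range N, 1 / ((j : ℝ) + 1)) := by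
    intro w hw
    have hwc : w ∈ closure R := hw.1
    have hwR : w ∉ R := by rw [hRo.frontier_eq] at hw; exact hw.2
    rw [hcl] at hwc
    have h1 : |w.re| ≤ N := abs_le.2 hwc.1
    have h2 : |w.im| ≤ N := abs_le.2 hwc.2
    have h3 : |w.re| = N ∨ |w.im| = N := by
      by_contra! hcon
      exact hwR ⟨abs_lt.1 (lt_of_le_of_ne h1 hcon.1), abs_lt.1 (lt_of_le_of_ne h2 hcon.2)⟩
    have hNw : (N : ℝ) ≤ ‖w‖ := by
      rcases h3 with h | h
      · exact h ▸ Complex.abs_re_le_norm w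
      · exact h ▸ Complex.abs_im_le_norm w
    have hw0 : w ≠ 0 := norm_pos_iff.1 (hN'.trans_le hNw)
    -- A pole on the boundary would be a root of modulus exactly N, but every positive root lies
    -- strictly between j + 1/2 and j + 1.
    have hdw : den p w ≠ 0 := by
      intro hd
      obtain ⟨μ, rfl, hμ⟩ := exists_charEq_of_den_eq_zero hp hd
      have hm : |μ| = N := by
        rcases h3 with h | h
        · simp at h; exact absurd h.symm hN'.ne'
        · simpa using h
      have hm' : CharEq p |μ| := by
        rcases abs_choice μ with e | e <;> rw [e]
        exacts [hμ, hμ.neg]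
      obtain ⟨j, hj⟩ := hm'.eq_root hp (hm ▸ hN')
      have hl := lt_root hp j
      have hu := root_lt hp j
      rw [← hj, hm] at hl hu
      have : j < N := by exact_mod_cast (by linarith : (j : ℝ) < N)
      have : N < j + 1 := by exact_mod_cast hu
      omega
    have hbd := norm_deflated_le hp hN h1 h3
    rw [dslope_of_ne _ hw0, slope_def_field, hE0, sub_zero, sub_zero, norm_div, hEd w hdw,
      div_le_iff₀ (hN'.trans_le hNw)]
    set H := ∑ j ∈ Finset.range N, 1 / ((j : ℝ) + 1)
    have hH : 0 ≤ H := Finset.sum_nonneg fun j _ => by positivity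
    set B := p + 2 + 2 * (2 * (p * Real.pi + 1)) * H with hB
    have hB0 : 0 ≤ B := (norm_nonneg _).trans hbd
    refine hbd.trans ?_
    calc B = B * (N : ℝ)⁻¹ * N := by field_simp
      _ ≤ B * (N : ℝ)⁻¹ * ‖w‖ := by gcongr
      _ = _ := by rw [hB]; ring
  have hzR : z ∈ R := ⟨abs_lt.1 hre, abs_lt.1 him⟩
  have hfin := Complex.norm_le_of_forall_mem_frontier_norm_le hb hds hfr (subset_closure hzR)
  have hz0 : z ≠ 0 := by
    rintro rfl
    simp [den] at hz
  rw [dslope_of_ne _ hz0, slope_def_field, hE0, sub_zero, sub_zero, norm_div, hEd z hz,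
    div_le_iff₀ (norm_pos_iff.2 hz0)] at hfin
  linarith

theorem tendsto_deflated (hp : 0 < p) {z : ℂ} (hz : den p z ≠ 0) :
    Tendsto (fun N : ℕ => deflated p (poleSet p N) z) atTop (𝓝 0) := by
  rw [tendsto_zero_iff_norm_tendsto_zero]
  have h1 : Tendsto (fun N : ℕ => (N : ℝ)⁻¹) atTop (𝓝 0) := tendsto_inv_atTop_nhds_zero_nat
  -- The harmonic sum over N is a Cesàro mean of a null sequence.
  have h2 : Tendsto (fun N : ℕ => (N : ℝ)⁻¹ * ∑ j ∈ Finset.range N, 1 / ((j : ℝ) + 1))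
      atTop (𝓝 0) := tendsto_one_div_add_atTop_nhds_zero_nat.cesaro
  have h3 := ((h1.const_mul (p + 2)).add (h2.const_mul (2 * (2 * (p * Real.pi + 1))))).const_mul ‖z‖
  rw [mul_zero, mul_zero, add_zero, mul_zero] at h3
  refine squeeze_zero' (Eventually.of_forall fun N => norm_nonneg _) ?_ h3
  filter_upwards [eventually_ge_atTop 1, tendsto_natCast_atTop_atTop.eventually_gt_atTop |z.re|,
    tendsto_natCast_atTop_atTop.eventually_gt_atTop |z.im|] with N hN1 hN2 hN3
  exact norm_deflated_le_mul hp hz hN1 hN2 hN3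

/-! ### Convergence of the partial fraction series -/

theorem root_sq_ge (hp : 0 < p) (j : ℕ) : ((j : ℝ) + 1) ^ 2 / 4 ≤ root p j ^ 2 := by
  have h1 := lt_root hp j
  have h2 : (0 : ℝ) ≤ j := j.cast_nonneg
  nlinarith

theorem summable_one_div_root_sq (hp : 0 < p) : Summable fun j => 1 / root p j ^ 2 := by
  have h : Summable fun j : ℕ => 4 * (1 / ((j : ℝ) + 1) ^ 2) := by
    have := (summable_nat_add_iff 1).2 (Real.summable_one_div_nat_pow.2 (le_refl 2))
    refine (this.mul_left 4).congr fun j => ?_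
    push_cast
    rfl
  refine Summable.of_nonneg_of_le (fun j => by positivity) (fun j => ?_) h
  have := root_sq_ge hp j
  calc 1 / root p j ^ 2 ≤ 1 / (((j : ℝ) + 1) ^ 2 / 4) :=
        one_div_le_one_div_of_le (by positivity) this
    _ = 4 * (1 / ((j : ℝ) + 1) ^ 2) := by field_simp

/-- With q = z² + μ², both factors z ∓ iμ have modulus at least Re z, so ‖z‖² ≤ ‖q‖·‖z‖²/(Re z)²,
and μ² ≤ ‖q‖ + ‖z‖². On a vertical line the bound is polynomial in ‖z‖ and summable over the roots,
as dominated convergence requires. -/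
theorem norm_div_sq_add_sq_le {z : ℂ} (hz : 0 < z.re) {μ : ℝ} (hμ : μ ≠ 0) :
    ‖z / (z ^ 2 + (μ : ℂ) ^ 2)‖ ≤ ‖z‖ * (1 + ‖z‖ ^ 2 / z.re ^ 2) * (1 / μ ^ 2) := by
  have hge : ∀ ν : ℝ, z.re ≤ ‖z - ν * Complex.I‖ := by
    intro ν
    have := Complex.abs_re_le_norm (z - ν * Complex.I)
    simp at this
    exact (le_abs_self _).trans this
  have e : z ^ 2 + (μ : ℂ) ^ 2 = (z - μ * Complex.I) * (z - (-μ : ℝ) * Complex.I) := by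
    push_cast
    linear_combination (μ : ℂ) ^ 2 * Complex.I_sq
  set q := z ^ 2 + (μ : ℂ) ^ 2 with hq
  have h1 : z.re ^ 2 ≤ ‖q‖ := by
    rw [e, norm_mul, sq]
    exact mul_le_mul (hge _) (hge _) hz.le (norm_nonneg _)
  have hqpos : 0 < ‖q‖ := lt_of_lt_of_le (by positivity) h1
  have h2 : μ ^ 2 ≤ ‖q‖ + ‖z‖ ^ 2 := by
    have : ((μ : ℂ) ^ 2) = q - z ^ 2 := by rw [hq]; ring
    have h3 := congrArg norm this
    rw [norm_pow, Complex.norm_real, Real.norm_eq_abs, sq_abs] at h3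
    rw [h3, ← norm_pow]
    exact norm_sub_le _ _
  have h3 : ‖z‖ ^ 2 ≤ ‖q‖ * (‖z‖ ^ 2 / z.re ^ 2) := by
    rw [mul_div_assoc', le_div_iff₀ (by positivity)]
    nlinarith [sq_nonneg ‖z‖]
  rw [norm_div, div_le_iff₀ hqpos, mul_one_div, div_mul_eq_mul_div, le_div_iff₀ (by positivity)]
  have : μ ^ 2 ≤ ‖q‖ * (1 + ‖z‖ ^ 2 / z.re ^ 2) := by linarith
  calc ‖z‖ * μ ^ 2 ≤ ‖z‖ * (‖q‖ * (1 + ‖z‖ ^ 2 / z.re ^ 2)) := by gcongr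
    _ = _ := by ring

theorem norm_ofReal_weight_le (hp : 0 < p) (x : ℝ) : ‖(koshliakovWeight p x : ℂ)‖ ≤ 1 := by
  rw [Complex.norm_real, Real.norm_of_nonneg (weight_pos hp x).le]
  exact weight_le_one hp x

/-- The partial fraction expansion of `num / (2 den)` in the right half-plane. -/
theorem hasSum_partialFractions (hp : 0 < p) {z : ℂ} (hz : 0 < z.re) :
    HasSum (fun j => koshliakovWeight p (root p j) * (z / (z ^ 2 + (root p j : ℂ) ^ 2)))
      (Real.pi * (num p z / (2 * den p z)) - koshliakovWeight p 0 / (2 * z)) := by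
  have hd := den_ne_zero_of_re_pos hp hz
  have hpi : (Real.pi : ℂ) ≠ 0 := by exact_mod_cast Real.pi_ne_zero
  have hs : Summable fun j =>
      (koshliakovWeight p (root p j) : ℂ) * (z / (z ^ 2 + (root p j : ℂ) ^ 2)) := by
    refine Summable.of_norm_bounded ((summable_one_div_root_sq hp).mul_left
      (‖z‖ * (1 + ‖z‖ ^ 2 / z.re ^ 2))) fun j => ?_
    rw [norm_mul]
    have := mul_le_mul (norm_ofReal_weight_le hp (root p j))
      (norm_div_sq_add_sq_le hz (root_pos hp j).ne') (norm_nonneg _) zero_le_one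
    simpa using this
  refine (Summable.hasSum_iff_tendsto_nat hs).2 ?_
  have h := ((tendsto_deflated hp hd).const_mul (-(Real.pi : ℂ))).add_const
    (Real.pi * (num p z / (2 * den p z)) - koshliakovWeight p 0 / (2 * z))
  rw [mul_zero, zero_add] at h
  refine h.congr fun N => ?_
  rw [deflated_eq hp N hd]
  have hz0 : z ≠ 0 := by rintro rfl; simp at hz
  have : ∑ j ∈ Finset.range N, koshliakovWeight p (root p j) * (z / (z ^ 2 + (root p j : ℂ) ^ 2)) =
      Real.pi * ∑ j ∈ Finset.range N,
        koshliakovWeight p (root p j) / Real.pi * (z / (z ^ 2 + (root p j : ℂ) ^ 2)) := by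
    rw [Finset.mul_sum]
    refine Finset.sum_congr rfl fun j _ => ?_
    field_simp
  rw [this]
  field_simp
  ring

/-! ### Gaussian integrals over vertical lines -/

theorem ofReal_cpow_half {r : ℝ} (hr : 0 ≤ r) : (r : ℂ) ^ (1 / 2 : ℂ) = (√r : ℝ) := by
  rw [Real.sqrt_eq_rpow, Complex.ofReal_cpow hr]
  norm_num

theorem norm_cexp_mul_line_sq (u c y : ℝ) :
    ‖Complex.exp (u * (c + y * Complex.I) ^ 2)‖ = Real.exp (u * c ^ 2) * Real.exp (-u * y ^ 2) := by
  rw [Complex.norm_exp, ← Real.exp_add]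
  congr 1
  simp [sq]
  ring

theorem integral_cexp_line {u : ℝ} (hu : 0 < u) (c x : ℝ) :
    ∫ y : ℝ, Complex.exp (u * (c + y * Complex.I) ^ 2 - x * (c + y * Complex.I)) =
      (√(Real.pi / u) * Real.exp (-(x ^ 2 / (4 * u))) : ℝ) := by
  have h := integral_cexp_quadratic (b := -(u : ℂ)) (by simpa using hu)
    ((2 * u * c - x) * Complex.I) (u * c ^ 2 - x * c)
  have hu' : (u : ℂ) ≠ 0 := by exact_mod_cast hu.ne'
  have e : ∀ y : ℝ, (u : ℂ) * (c + y * Complex.I) ^ 2 - x * (c + y * Complex.I) =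
      -(u : ℂ) * y ^ 2 + (2 * u * c - x) * Complex.I * y + (u * c ^ 2 - x * c) := by
    intro y
    linear_combination (u : ℂ) * y ^ 2 * Complex.I_sq
  simp only [e]
  rw [h, neg_neg]
  have e1 : ((Real.pi : ℂ) / u) = ((Real.pi / u : ℝ) : ℂ) := by push_cast; rfl
  have hpi := Real.pi_pos
  rw [e1, ofReal_cpow_half (by positivity), Complex.ofReal_mul, Complex.ofReal_exp]
  congr 2
  push_cast
  field_simp
  linear_combination (2 * u * c - x : ℂ) ^ 2 * Complex.I_sq

theorem integral_cos_mul_gaussian {u : ℝ} (hu : 0 < u) (μ : ℝ) :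
    ∫ x in Ioi (0 : ℝ), Real.cos (μ * x) * Real.exp (-(x ^ 2 / (4 * u))) =
      √(Real.pi * u) * Real.exp (-u * μ ^ 2) := by
  have h := integral_cexp_quadratic (b := -((1 / (4 * u) : ℝ) : ℂ)) (by simp; positivity)
    (μ * Complex.I) 0
  have hint := integrable_cexp_quadratic' (b := -((1 / (4 * u) : ℝ) : ℂ)) (by simp; positivity)
    (μ * Complex.I) 0
  have hre := integral_re hint
  rw [h] at hre
  have e : ∀ x : ℝ, RCLike.re (Complex.exp (-((1 / (4 * u) : ℝ) : ℂ) * x ^ 2 + μ * Complex.I * x + 0)) =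
      Real.cos (μ * |x|) * Real.exp (-(|x| ^ 2 / (4 * u))) := by
    intro x
    have h1 : -((1 / (4 * u) : ℝ) : ℂ) * x ^ 2 + μ * Complex.I * x + 0 =
        (-(x ^ 2 / (4 * u)) : ℝ) + (μ * x : ℝ) * Complex.I := by
      push_cast; ring
    have h2 : Real.cos (μ * |x|) = Real.cos (μ * x) := by
      rw [← Real.cos_abs, abs_mul, abs_abs, ← abs_mul, Real.cos_abs]
    rw [h1, Complex.exp_add, ← Complex.ofReal_exp, h2, sq_abs]
    change Complex.re _ = _
    rw [Complex.re_ofReal_mul, Complex.exp_ofReal_mul_I_re]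
    ring
  simp only [e] at hre
  rw [integral_comp_abs (f := fun x => Real.cos (μ * x) * Real.exp (-(x ^ 2 / (4 * u))))] at hre
  have hpi := Real.pi_pos
  have e1 : ((Real.pi : ℂ) / -(-((1 / (4 * u) : ℝ) : ℂ))) = ((4 * (Real.pi * u) : ℝ) : ℂ) := by
    push_cast; field_simp
  have e2 : (0 : ℂ) - (μ * Complex.I) ^ 2 / (4 * -((1 / (4 * u) : ℝ) : ℂ)) =
      ((-u * μ ^ 2 : ℝ) : ℂ) := by
    have hu' : (u : ℂ) ≠ 0 := by exact_mod_cast hu.ne'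
    push_cast
    field_simp
    linear_combination (u : ℂ) * μ ^ 2 * Complex.I_sq
  rw [e1, e2, ofReal_cpow_half (by positivity), ← Complex.ofReal_exp, ← Complex.ofReal_mul] at hre
  rw [RCLike.re_eq_complex_re, Complex.ofReal_re, Real.sqrt_mul (by norm_num), show (4 : ℝ) = 2 ^ 2 by norm_num,
    Real.sqrt_sq (by norm_num)] at hre
  linarith

theorem integral_cexp_neg_mul_cos {z : ℂ} (hz : 0 < z.re) (μ : ℝ) :
    ∫ x in Ioi (0 : ℝ), Complex.exp (-(x * z)) * Real.cos (μ * x) =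
      z / (z ^ 2 + (μ : ℂ) ^ 2) := by
  have h1 : (-z + μ * Complex.I).re < 0 := by simpa using hz
  have h2 : (-z - μ * Complex.I).re < 0 := by simpa using hz
  have e : ∀ x : ℝ, Complex.exp (-(x * z)) * Real.cos (μ * x) =
      Complex.exp ((-z + μ * Complex.I) * x) / 2 + Complex.exp ((-z - μ * Complex.I) * x) / 2 := by
    intro x
    rw [Complex.ofReal_cos, Complex.cos, mul_div_assoc', mul_add, ← Complex.exp_add,
      ← Complex.exp_add, add_div]
    congr 3 <;> (push_cast; ring)
  simp only [e]
  rw [integral_add ((integrableOn_exp_mul_complex_Ioi h1 0).div_const 2)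
    ((integrableOn_exp_mul_complex_Ioi h2 0).div_const 2), integral_div, integral_div,
    integral_exp_mul_complex_Ioi h1, integral_exp_mul_complex_Ioi h2]
  have n1 : -z + μ * Complex.I ≠ 0 := by intro h; rw [h] at h1; simp at h1
  have n2 : -z - μ * Complex.I ≠ 0 := by intro h; rw [h] at h2; simp at h2
  have e3 : z ^ 2 + (μ : ℂ) ^ 2 = (-z + μ * Complex.I) * (-z - μ * Complex.I) := by
    linear_combination (μ : ℂ) ^ 2 * Complex.I_sq
  rw [e3]
  simp only [Complex.ofReal_zero, mul_zero, Complex.exp_zero]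
  field_simp
  ring

/-- Write z/(z² + μ²) as the Laplace transform of cos μx and apply Fubini: the line integral becomes
a Gaussian in x, whose cosine transform is known. No contour is moved, and μ = 0 is allowed. -/
theorem integral_line_partialFraction {u c : ℝ} (hu : 0 < u) (hc : 0 < c) (μ : ℝ) :
    ∫ y : ℝ, (c + y * Complex.I) / ((c + y * Complex.I) ^ 2 + (μ : ℂ) ^ 2) *
      Complex.exp (u * (c + y * Complex.I) ^ 2) =
      (Real.pi * Real.exp (-u * μ ^ 2) : ℝ) := by
  set f : ℝ → ℝ → ℂ := fun y x =>
    Complex.exp (u * (c + y * Complex.I) ^ 2) *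
      (Complex.exp (-(x * (c + y * Complex.I))) * Real.cos (μ * x)) with hf
  have hcont : Continuous (Function.uncurry f) := by
    rw [hf]; unfold Function.uncurry; fun_prop
  have hdom : Integrable (fun q : ℝ × ℝ => (Real.exp (u * c ^ 2) * Real.exp (-u * q.1 ^ 2)) *
      Real.exp (-c * q.2)) (volume.prod (volume.restrict (Ioi 0))) :=
    Integrable.mul_prod (μ := volume) (ν := volume.restrict (Ioi 0))
      (f := fun y : ℝ => Real.exp (u * c ^ 2) * Real.exp (-u * y ^ 2))
      (g := fun x : ℝ => Real.exp (-c * x))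
      ((integrable_exp_neg_mul_sq hu).const_mul _) (exp_neg_integrableOn_Ioi 0 hc)
  have hint : Integrable (Function.uncurry f) (volume.prod (volume.restrict (Ioi 0))) := by
    refine hdom.mono' hcont.aestronglyMeasurable (Eventually.of_forall ?_)
    rintro ⟨y, x⟩
    simp only [Function.uncurry, hf]
    rw [norm_mul, norm_cexp_mul_line_sq, norm_mul]
    refine mul_le_mul_of_nonneg_left ?_ (by positivity)
    have h1 : ‖Complex.exp (-(x * (c + y * Complex.I)))‖ = Real.exp (-c * x) := by
      rw [Complex.norm_exp]; simp [mul_comm]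
    have h2 : ‖((Real.cos (μ * x) : ℝ) : ℂ)‖ ≤ 1 := by
      rw [Complex.norm_real]; exact Real.abs_cos_le_one _
    rw [h1]
    exact mul_le_of_le_one_right (Real.exp_pos _).le h2
  have hswap := integral_integral_swap hint
  have hL : ∀ y : ℝ, ∫ x in Ioi (0 : ℝ), f y x =
      (c + y * Complex.I) / ((c + y * Complex.I) ^ 2 + (μ : ℂ) ^ 2) *
      Complex.exp (u * (c + y * Complex.I) ^ 2) := by
    intro y
    simp only [hf]
    rw [integral_const_mul, integral_cexp_neg_mul_cos (by simpa using hc), mul_comm]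
  have hR : ∀ x : ℝ, ∫ y : ℝ, f y x =
      ((√(Real.pi / u) * (Real.cos (μ * x) * Real.exp (-(x ^ 2 / (4 * u)))) : ℝ) : ℂ) := by
    intro x
    have e : ∀ y : ℝ, f y x =
        Complex.exp (u * (c + y * Complex.I) ^ 2 - x * (c + y * Complex.I)) * Real.cos (μ * x) := by
      intro y
      simp only [hf]
      rw [← mul_assoc, ← Complex.exp_add, ← sub_eq_add_neg]
    simp only [e]
    rw [integral_mul_const, integral_cexp_line hu]
    push_cast
    ring
  simp only [hL, hR] at hswap
  rw [hswap, integral_complex_ofReal, integral_const_mul, integral_cos_mul_gaussian hu]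
  congr 1
  have hpi := Real.pi_pos
  rw [← mul_assoc, ← Real.sqrt_mul (by positivity), show Real.pi / u * (Real.pi * u) = Real.pi ^ 2 by
    field_simp, Real.sqrt_sq hpi.le]

/-! ### The kernel `ψ` -/

/-- `1 / (σ(z) e^{2πz} - 1)`, continued across the pole of `σ`. -/
noncomputable def psi (p : ℝ) (z : ℂ) : ℂ := num p z / (2 * den p z) - 1 / 2

/-- Here ψ = (p−z)e^{−πz}/(2 den), and |2 den| ≥ |p+z|(e^{πx} − e^{−πx}) with x = Re z; the factor
|p−z|/|p+z| is at most 1. The bound is constant on vertical lines. -/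
theorem norm_psi_le (hp : 0 < p) {z : ℂ} (hz : 0 < z.re) :
    ‖psi p z‖ ≤ 1 / (Real.exp (2 * (Real.pi * z.re)) - 1) := by
  have hd := den_ne_zero_of_re_pos hp hz
  have hpz := mul_pos Real.pi_pos hz
  have e : psi p z = (p - z) * Complex.exp (-(Real.pi * z)) / (2 * den p z) := by
    rw [psi, eq_div_iff (by simpa using hd), sub_mul, div_mul_cancel₀ _ (by simpa using hd),
      num_eq, den_eq]
    ring
  have h1 := norm_sub_le_norm_add hp hz.le
  have h2 := norm_add_pos hp hz.le
  have h3 : ‖(p : ℂ) + z‖ * (Real.exp (Real.pi * z.re) - Real.exp (-(Real.pi * z.re))) ≤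
      ‖2 * den p z‖ := by
    have : 2 * den p z = (p + z) * Complex.exp (Real.pi * z) -
        (p - z) * Complex.exp (-(Real.pi * z)) := by
      rw [den_eq]; ring
    rw [this]
    refine le_trans ?_ (norm_sub_norm_le _ _)
    rw [norm_mul, norm_mul, norm_exp_pi_mul, norm_exp_neg_pi_mul]
    have := mul_le_mul_of_nonneg_right h1 (Real.exp_pos (-(Real.pi * z.re))).le
    linarith
  have h4 : 0 < Real.exp (Real.pi * z.re) - Real.exp (-(Real.pi * z.re)) := by
    rw [sub_pos, Real.exp_lt_exp]; linarith
  rw [e, norm_div, norm_mul, norm_exp_neg_pi_mul]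
  calc _ ≤ ‖(p : ℂ) + z‖ * Real.exp (-(Real.pi * z.re)) /
        (‖(p : ℂ) + z‖ * (Real.exp (Real.pi * z.re) - Real.exp (-(Real.pi * z.re)))) := by gcongr
    _ = Real.exp (-(Real.pi * z.re)) /
        (Real.exp (Real.pi * z.re) - Real.exp (-(Real.pi * z.re))) :=
        mul_div_mul_left _ _ h2.ne'
    _ = 1 / (Real.exp (2 * (Real.pi * z.re)) - 1) := by
      have h5 : 1 < Real.exp (2 * (Real.pi * z.re)) := Real.one_lt_exp_iff.2 (by linarith)
      have h6 : Real.exp (Real.pi * z.re) =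
          Real.exp (2 * (Real.pi * z.re)) * Real.exp (-(Real.pi * z.re)) := by
        rw [← Real.exp_add]; ring_nf
      rw [div_eq_div_iff h4.ne' (by linarith), h6]
      ring

theorem measurable_psi_line (c : ℝ) : Measurable fun y : ℝ => psi p (c + y * Complex.I) := by
  have h : Measurable fun y : ℝ => (c : ℂ) + y * Complex.I := by fun_prop
  unfold psi
  exact ((differentiable_num.continuous.measurable.comp h).div
    ((differentiable_den.continuous.measurable.comp h).const_mul 2)).sub_const _

/-! ### The theta function -/

/-- `∑ w_j λ_j^{2k} e^{-u λ_j²}`. -/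
noncomputable def rootTheta (p : ℝ) (k : ℕ) (u : ℝ) : ℝ :=
  ∑' j, koshliakovWeight p (root p j) * root p j ^ (2 * k) * Real.exp (-u * root p j ^ 2)

/-- `∫_0^∞ x^{2k} e^{-u x²} dx`. -/
noncomputable def gaussMoment (k : ℕ) (u : ℝ) : ℝ :=
  Real.Gamma (k + 1 / 2) / 2 * u ^ (-((k : ℝ) + 1 / 2))

/-- The moment of order `2k` of `e^{-u x²}` against `∑ w_j δ_{λ_j} - dx` plus half of a point mass
`w(0)` at the origin. -/
noncomputable def theta (p : ℝ) (k : ℕ) (u : ℝ) : ℝ :=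
  rootTheta p k u - gaussMoment k u + if k = 0 then koshliakovWeight p 0 / 2 else 0

theorem exp_neg_le_factorial_div_pow {n : ℕ} {v : ℝ} (hv : 0 < v) :
    Real.exp (-v) ≤ n.factorial / v ^ n := by
  have := Real.pow_div_factorial_le_exp v hv.le n
  rw [Real.exp_neg, ← inv_div]
  exact inv_anti₀ (by positivity) this

theorem rootTheta_term_le (hp : 0 < p) (k : ℕ) {u : ℝ} (hu : 0 < u) (j : ℕ) :
    koshliakovWeight p (root p j) * root p j ^ (2 * k) * Real.exp (-u * root p j ^ 2) ≤
      (k + 1).factorial / u ^ (k + 1) * (1 / root p j ^ 2) := by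
  have hr := root_pos hp j
  have h1 := exp_neg_le_factorial_div_pow (n := k + 1) (v := u * root p j ^ 2) (by positivity)
  calc koshliakovWeight p (root p j) * root p j ^ (2 * k) * Real.exp (-u * root p j ^ 2)
      ≤ 1 * root p j ^ (2 * k) * ((k + 1).factorial / (u * root p j ^ 2) ^ (k + 1)) := by
        rw [← neg_mul] at h1
        have := weight_le_one hp (root p j)
        gcongr
    _ = (k + 1).factorial / u ^ (k + 1) * (1 / root p j ^ 2) := by
        rw [mul_pow, ← pow_mul, show 2 * (k + 1) = 2 * k + 2 by ring, pow_add]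
        field_simp
        ring

theorem rootTheta_term_nonneg (hp : 0 < p) (k : ℕ) (u : ℝ) (j : ℕ) :
    0 ≤ koshliakovWeight p (root p j) * root p j ^ (2 * k) * Real.exp (-u * root p j ^ 2) := by
  have := weight_pos hp (root p j)
  have := root_pos hp j
  positivity

theorem hasSum_rootTheta (hp : 0 < p) (k : ℕ) {u : ℝ} (hu : 0 < u) :
    HasSum (fun j => koshliakovWeight p (root p j) * root p j ^ (2 * k) *
      Real.exp (-u * root p j ^ 2)) (rootTheta p k u) :=
  (Summable.of_nonneg_of_le (rootTheta_term_nonneg hp k u) (rootTheta_term_le hp k hu)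
    ((summable_one_div_root_sq hp).mul_left _)).hasSum

theorem rootTheta_nonneg (hp : 0 < p) (k : ℕ) (u : ℝ) : 0 ≤ rootTheta p k u :=
  tsum_nonneg (rootTheta_term_nonneg hp k u)

theorem rootTheta_le (hp : 0 < p) (k : ℕ) {u : ℝ} (hu : 0 < u) :
    rootTheta p k u ≤ (k + 1).factorial * (∑' j, 1 / root p j ^ 2) / u ^ (k + 1) := by
  rw [mul_div_right_comm, ← tsum_mul_left]
  exact (hasSum_rootTheta hp k hu).summable.tsum_le_tsum (rootTheta_term_le hp k hu)
    ((summable_one_div_root_sq hp).mul_left _)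

theorem gaussMoment_zero {u : ℝ} (hu : 0 < u) : gaussMoment 0 u = √(Real.pi / u) / 2 := by
  rw [gaussMoment, Nat.cast_zero, zero_add, Real.Gamma_one_half_eq, Real.rpow_neg hu.le,
    ← Real.sqrt_eq_rpow, Real.sqrt_div Real.pi_pos.le]
  ring

theorem integrable_cexp_line {u : ℝ} (hu : 0 < u) (c : ℝ) :
    Integrable fun y : ℝ => Complex.exp (u * (c + y * Complex.I) ^ 2) := by
  refine ((integrable_exp_neg_mul_sq hu).const_mul (Real.exp (u * c ^ 2))).mono'
    (by fun_prop) (Eventually.of_forall fun y => ?_)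
  rw [norm_cexp_mul_line_sq]

theorem integrable_psi_line (hp : 0 < p) {u c : ℝ} (hu : 0 < u) (hc : 0 < c) :
    Integrable fun y : ℝ =>
      psi p (c + y * Complex.I) * Complex.exp (u * (c + y * Complex.I) ^ 2) := by
  refine (integrable_cexp_line hu c).bdd_mul (measurable_psi_line c).aestronglyMeasurable
    (c := 1 / (Real.exp (2 * (Real.pi * c)) - 1)) (Eventually.of_forall fun y => ?_)
  simpa using norm_psi_le hp (z := c + y * Complex.I) (by simpa using hc)

theorem integrable_dominating {u c : ℝ} (hu : 0 < u) (hc : 0 < c) :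
    Integrable fun y : ℝ => ‖(c : ℂ) + y * Complex.I‖ *
      (1 + ‖(c : ℂ) + y * Complex.I‖ ^ 2 / c ^ 2) * (Real.exp (u * c ^ 2) * Real.exp (-u * y ^ 2)) := by
  have hm : ∀ n : ℕ, Integrable fun y : ℝ => y ^ n * Real.exp (-u * y ^ 2) := by
    intro n
    have := integrable_rpow_mul_exp_neg_mul_sq hu (s := n)
      (by have : (0 : ℝ) ≤ n := n.cast_nonneg
          linarith)
    simpa using this
  have hdom : Integrable fun y : ℝ => Real.exp (u * c ^ 2) *
      ((1 + c ^ 2) * 2 * (y ^ 0 * Real.exp (-u * y ^ 2)) +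
      ((1 + c ^ 2) / c ^ 2 + 2) * (y ^ 2 * Real.exp (-u * y ^ 2)) +
      1 / c ^ 2 * (y ^ 4 * Real.exp (-u * y ^ 2))) :=
    ((((hm 0).const_mul _).add ((hm 2).const_mul _)).add ((hm 4).const_mul _)).const_mul _
  refine hdom.mono' (by fun_prop) (Eventually.of_forall fun y => ?_)
  rw [Real.norm_of_nonneg (by positivity)]
  set r := ‖(c : ℂ) + y * Complex.I‖ with hr
  have h2 : r ^ 2 = c ^ 2 + y ^ 2 := by
    rw [hr, Complex.sq_norm, Complex.normSq_apply]; simp; ring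
  have h1 : r ≤ 1 + c ^ 2 + y ^ 2 := by nlinarith [sq_nonneg (r - 1)]
  rw [h2]
  calc r * (1 + (c ^ 2 + y ^ 2) / c ^ 2) * (Real.exp (u * c ^ 2) * Real.exp (-u * y ^ 2))
      ≤ (1 + c ^ 2 + y ^ 2) * (1 + (c ^ 2 + y ^ 2) / c ^ 2) *
        (Real.exp (u * c ^ 2) * Real.exp (-u * y ^ 2)) := by gcongr
    _ = _ := by field_simp; ring

/-- The partial fractions are multiplied by e^{uz²} and integrated term by term. The 1/2 separating
ψ from num/(2 den) produces the Gaussian term √(π/u)/2, and the pole at 0 produces w(0)/2. -/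
theorem theta_zero_eq_integral (hp : 0 < p) {u c : ℝ} (hu : 0 < u) (hc : 0 < c) :
    (theta p 0 u : ℂ) = ∫ y : ℝ, psi p (c + y * Complex.I) *
      Complex.exp (u * (c + y * Complex.I) ^ 2) := by
  have hre : ∀ y : ℝ, ((c : ℂ) + y * Complex.I).re = c := by simp
  have hpi : (Real.pi : ℂ) ≠ 0 := by exact_mod_cast Real.pi_ne_zero
  have hz : ∀ y : ℝ, (c : ℂ) + y * Complex.I ≠ 0 := by
    intro y h
    have := congrArg Complex.re h
    rw [hre] at this
    exact hc.ne' this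
  have hsum := hasSum_integral_of_dominated_convergence (μ := volume)
    (F := fun (j : ℕ) (y : ℝ) => koshliakovWeight p (root p j) *
      ((c + y * Complex.I) / ((c + y * Complex.I) ^ 2 + (root p j : ℂ) ^ 2)) *
        Complex.exp (u * (c + y * Complex.I) ^ 2))
    (f := fun y : ℝ => (Real.pi * (num p (c + y * Complex.I) / (2 * den p (c + y * Complex.I))) -
      koshliakovWeight p 0 / (2 * (c + y * Complex.I))) *
        Complex.exp (u * (c + y * Complex.I) ^ 2))
    (fun (j : ℕ) (y : ℝ) => (‖(c : ℂ) + y * Complex.I‖ *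
      (1 + ‖(c : ℂ) + y * Complex.I‖ ^ 2 / c ^ 2) * (Real.exp (u * c ^ 2) * Real.exp (-u * y ^ 2))) *
      (1 / root p j ^ 2))
    (fun j => Measurable.aestronglyMeasurable (by fun_prop))
    (fun j => Eventually.of_forall fun y => by
      rw [norm_mul, norm_mul, norm_cexp_mul_line_sq]
      have h1 := norm_ofReal_weight_le hp (root p j)
      have h2 := norm_div_sq_add_sq_le (z := c + y * Complex.I) (by rw [hre]; exact hc)
        (root_pos hp j).ne'
      rw [hre] at h2
      have := mul_le_mul h1 h2 (norm_nonneg _) zero_le_one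
      rw [one_mul] at this
      exact (mul_le_mul_of_nonneg_right this
        (mul_pos (Real.exp_pos (u * c ^ 2)) (Real.exp_pos (-u * y ^ 2))).le).trans_eq (by ring))
    (Eventually.of_forall fun y => (summable_one_div_root_sq hp).mul_left _)
    (by simp only [tsum_mul_left]; exact (integrable_dominating hu hc).mul_const _)
    (Eventually.of_forall fun y =>
      (hasSum_partialFractions hp (z := c + y * Complex.I) (by rw [hre]; exact hc)).mul_right _)
  have hterm : ∀ j : ℕ, ∫ y : ℝ, koshliakovWeight p (root p j) *
      ((c + y * Complex.I) / ((c + y * Complex.I) ^ 2 + (root p j : ℂ) ^ 2)) *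
        Complex.exp (u * (c + y * Complex.I) ^ 2) =
      ((Real.pi * (koshliakovWeight p (root p j) * root p j ^ (2 * 0) *
        Real.exp (-u * root p j ^ 2)) : ℝ) : ℂ) := by
    intro j
    simp only [mul_assoc]
    rw [integral_const_mul, integral_line_partialFraction hu hc]
    push_cast
    ring
  simp only [hterm] at hsum
  have h1 := hsum.unique (Complex.hasSum_ofReal.2 ((hasSum_rootTheta hp 0 hu).mul_left Real.pi))
  have hG := integral_cexp_line hu c 0
  have h0 := integral_line_partialFraction hu hc 0
  -- The pole at 0 is the case μ = 0 of the line integral.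
  have hinv : ∀ y : ℝ, (c + y * Complex.I) / ((c + y * Complex.I) ^ 2 + ((0 : ℝ) : ℂ) ^ 2) =
      1 / (c + y * Complex.I) := by
    intro y
    have := hz y
    rw [Complex.ofReal_zero]
    field_simp
    simp
  simp only [hinv] at h0
  have hI0 : Integrable fun y : ℝ => 1 / ((c : ℂ) + y * Complex.I) *
      Complex.exp (u * (c + y * Complex.I) ^ 2) := by
    refine (integrable_cexp_line hu c).bdd_mul (c := 1 / c)
      (Measurable.aestronglyMeasurable (by fun_prop)) (Eventually.of_forall fun y => ?_)
    rw [norm_div, norm_one]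
    refine one_div_le_one_div_of_le hc ?_
    have := Complex.re_le_norm ((c : ℂ) + y * Complex.I)
    rwa [hre] at this
  have hsplit : ∀ y : ℝ,
      (Real.pi * (num p (c + y * Complex.I) / (2 * den p (c + y * Complex.I))) -
      koshliakovWeight p 0 / (2 * (c + y * Complex.I))) *
        Complex.exp (u * (c + y * Complex.I) ^ 2) =
      Real.pi * (psi p (c + y * Complex.I) * Complex.exp (u * (c + y * Complex.I) ^ 2)) +
      Real.pi / 2 * Complex.exp (u * (c + y * Complex.I) ^ 2) -
      koshliakovWeight p 0 / 2 * (1 / (c + y * Complex.I) *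
        Complex.exp (u * (c + y * Complex.I) ^ 2)) := by
    intro y
    have := hz y
    rw [psi]
    field_simp
    ring
  simp only [hsplit] at h1
  rw [integral_sub (((integrable_psi_line hp hu hc).const_mul _).fun_add
    ((integrable_cexp_line hu c).const_mul _)) (hI0.const_mul _),
    integral_add ((integrable_psi_line hp hu hc).const_mul _)
    ((integrable_cexp_line hu c).const_mul _), integral_const_mul, integral_const_mul,
    integral_const_mul, h0] at h1
  simp only [Complex.ofReal_zero, zero_mul, sub_zero] at hG
  rw [hG] at h1
  rw [theta, if_pos rfl, gaussMoment_zero hu]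
  apply mul_left_cancel₀ hpi
  simp only [ne_eq, OfNat.ofNat_ne_zero, not_false_eq_true, zero_pow, mul_zero, zero_div, neg_zero,
    Real.exp_zero, mul_one] at h1
  push_cast at h1 ⊢
  linear_combination -h1

/-- From e^a − 1 = 2 sinh(a/2) e^{a/2}. The factor a keeps the bound sharp enough for small a, so
that it serves every u > 0. -/
theorem mul_pow_div_factorial_le_exp_sub_one {a : ℝ} (ha : 0 < a) (n : ℕ) :
    a * ((a / 2) ^ n / n.factorial) ≤ Real.exp a - 1 := by
  have h1 := Real.pow_div_factorial_le_exp (a / 2) (by positivity) n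
  have h2 := Real.self_le_sinh_iff.2 (by positivity : 0 ≤ a / 2)
  have h3 : Real.exp a - 1 = 2 * Real.sinh (a / 2) * Real.exp (a / 2) := by
    rw [Real.sinh_eq, mul_div_cancel₀ _ two_ne_zero, sub_mul, ← Real.exp_add, ← Real.exp_add,
      add_halves, neg_add_cancel, Real.exp_zero]
  rw [h3]
  exact mul_le_mul (by linarith) h1 (by positivity) (by linarith)

/-- The theta function is flat at the origin. -/
theorem abs_theta_zero_le (hp : 0 < p) (n : ℕ) {u : ℝ} (hu : 0 < u) :
    |theta p 0 u| ≤ √Real.pi * 2 ^ n * n.factorial * u ^ n * √u := by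
  have hpi := Real.pi_pos
  -- On this line e^{uc²} = e^c, while ψ is of order e^{−2πc} for large c; the product is
  -- exponentially small in 1/u.
  obtain ⟨c, hc⟩ : ∃ c : ℝ, c = 1 / u := ⟨_, rfl⟩
  have hcpos : 0 < c := by rw [hc]; positivity
  have h1 := theta_zero_eq_integral hp hu hcpos
  have h2 : ‖∫ y : ℝ, psi p (c + y * Complex.I) * Complex.exp (u * (c + y * Complex.I) ^ 2)‖ ≤
      ∫ y : ℝ, 1 / (Real.exp (2 * (Real.pi * c)) - 1) *
        (Real.exp (u * c ^ 2) * Real.exp (-u * y ^ 2)) := by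
    refine norm_integral_le_of_norm_le
      (((integrable_exp_neg_mul_sq hu).const_mul _).const_mul _) (Eventually.of_forall fun y => ?_)
    rw [norm_mul, norm_cexp_mul_line_sq]
    have := norm_psi_le hp (z := c + y * Complex.I) (by simpa using hcpos)
    simp only [Complex.add_re, Complex.ofReal_re, Complex.mul_re, Complex.I_re, mul_zero,
      Complex.ofReal_im, Complex.I_im, mul_one, sub_self, add_zero] at this
    gcongr
  rw [← h1, Complex.norm_real, Real.norm_eq_abs, integral_const_mul, integral_const_mul,
    integral_gaussian] at h2
  refine h2.trans ?_
  have h3 := mul_pow_div_factorial_le_exp_sub_one hcpos n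
  set D := c * ((c / 2) ^ n / n.factorial) with hD
  have hDpos : 0 < D := by positivity
  have h4 : Real.exp (u * c ^ 2) = Real.exp c := by
    rw [hc]; congr 1; field_simp
  have h5 : Real.exp c * D ≤ Real.exp (2 * (Real.pi * c)) - 1 := by
    have h6 : Real.exp c * Real.exp c ≤ Real.exp (2 * (Real.pi * c)) := by
      rw [← Real.exp_add, Real.exp_le_exp]
      nlinarith [Real.pi_gt_three]
    have h7 : 1 ≤ Real.exp c := Real.one_le_exp hcpos.le
    nlinarith [mul_le_mul_of_nonneg_left h3 (Real.exp_pos c).le]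
  have hE := Real.exp_pos c
  calc 1 / (Real.exp (2 * (Real.pi * c)) - 1) * (Real.exp (u * c ^ 2) * √(Real.pi / u))
      ≤ 1 / (Real.exp c * D) * (Real.exp c * √(Real.pi / u)) := by
        rw [h4]; gcongr
    _ = √(Real.pi / u) / D := by field_simp
    _ = _ := by
      rw [Real.sqrt_div hpi.le, hD, hc]
      have h8 : √u * √u = u := Real.mul_self_sqrt hu.le
      have h9 : √u ≠ 0 := (Real.sqrt_pos.2 hu).ne'
      have h10 : u = √u ^ 2 := by rw [sq, h8]
      have h11 : (1 / (u * 2)) ^ n * 2 ^ n * u ^ n = 1 := by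
        rw [← mul_pow, ← mul_pow, show 1 / (u * 2) * 2 * u = 1 by field_simp, one_pow]
      field_simp
      rw [sq, h8]
      linear_combination -u * h11

/-! ### Derivatives and bounds for the theta functions -/

theorem hasDerivAt_rootTheta (hp : 0 < p) (k : ℕ) {u : ℝ} (hu : 0 < u) :
    HasDerivAt (rootTheta p k) (-rootTheta p (k + 1) u) u := by
  have hu2 : 0 < u / 2 := by positivity
  have hterm : ∀ (j : ℕ) (v : ℝ), HasDerivAt
      (fun v => koshliakovWeight p (root p j) * root p j ^ (2 * k) * Real.exp (-v * root p j ^ 2))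
      (-(koshliakovWeight p (root p j) * root p j ^ (2 * (k + 1)) * Real.exp (-v * root p j ^ 2)))
      v := by
    intro j v
    have h1 : HasDerivAt (fun v : ℝ => -v * root p j ^ 2) (-root p j ^ 2) v := by
      simpa using (hasDerivAt_neg v).mul_const (root p j ^ 2)
    refine (h1.exp.const_mul _).congr_deriv ?_
    ring
  -- On (u/2, ∞) the differentiated terms have a summable bound independent of v.
  have h := hasDerivAt_tsum_of_isPreconnected (t := Ioi (u / 2)) (y₀ := u) (y := u)
    (((summable_one_div_root_sq hp).mul_left (((k + 1) + 1).factorial / (u / 2) ^ ((k + 1) + 1))))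
    isOpen_Ioi isPreconnected_Ioi (fun j v _ => hterm j v)
    (fun j v hv => by
      rw [norm_neg, Real.norm_of_nonneg (rootTheta_term_nonneg hp (k + 1) v j)]
      refine (rootTheta_term_le hp (k + 1) (hu2.trans hv) j).trans ?_
      have := root_pos hp j
      have : u / 2 < v := hv
      gcongr)
    (mem_Ioi.2 (by linarith)) (hasSum_rootTheta hp k hu).summable (mem_Ioi.2 (by linarith))
  rw [tsum_neg] at h
  exact h

theorem hasDerivAt_gaussMoment (k : ℕ) {u : ℝ} (hu : 0 < u) :
    HasDerivAt (gaussMoment k) (-gaussMoment (k + 1) u) u := by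
  have h := ((Real.hasDerivAt_rpow_const (p := -((k : ℝ) + 1 / 2)) (Or.inl hu.ne')).const_mul
    (Real.Gamma (k + 1 / 2) / 2))
  refine h.congr_deriv ?_
  have hG : Real.Gamma ((k + 1 : ℕ) + 1 / 2) = (k + 1 / 2) * Real.Gamma (k + 1 / 2) := by
    rw [← Real.Gamma_add_one (by positivity)]
    push_cast
    congr 1
    ring
  rw [gaussMoment, hG]
  have e : -(((k + 1 : ℕ) : ℝ) + 1 / 2) = -((k : ℝ) + 1 / 2) - 1 := by push_cast; ring
  rw [e]
  ring

/-- So `theta p k` is (−1)^k times the k-th derivative of `theta p 0` on u > 0; the constant w(0)/2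
disappears at the first differentiation. -/
theorem hasDerivAt_theta (hp : 0 < p) (k : ℕ) {u : ℝ} (hu : 0 < u) :
    HasDerivAt (theta p k) (-theta p (k + 1) u) u := by
  have h := ((hasDerivAt_rootTheta hp k hu).sub (hasDerivAt_gaussMoment k hu)).add_const
    (if k = 0 then koshliakovWeight p 0 / 2 else 0)
  refine h.congr_deriv ?_
  rw [theta, if_neg (Nat.succ_ne_zero k)]
  ring

theorem continuousOn_theta (hp : 0 < p) (k : ℕ) : ContinuousOn (theta p k) (Ioi 0) :=
  fun _ hu => (hasDerivAt_theta hp k hu).continuousAt.continuousWithinAt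

theorem continuousOn_rootTheta (hp : 0 < p) (k : ℕ) : ContinuousOn (rootTheta p k) (Ioi 0) :=
  fun _ hu => (hasDerivAt_rootTheta hp k hu).continuousAt.continuousWithinAt

/-! ### Size of the theta functions at 0 and at infinity -/

theorem gaussMoment_nonneg (k : ℕ) {u : ℝ} (hu : 0 < u) : 0 ≤ gaussMoment k u := by
  have : 0 < Real.Gamma ((k : ℝ) + 1 / 2) := Real.Gamma_pos_of_pos (by positivity)
  unfold gaussMoment
  positivity

theorem abs_theta_le (hp : 0 < p) (k : ℕ) {u : ℝ} (hu : 0 < u) :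
    |theta p k u| ≤ rootTheta p k u + gaussMoment k u + if k = 0 then 1 else 0 := by
  have h1 := rootTheta_nonneg hp k u
  have h2 := gaussMoment_nonneg k hu
  have h3 := weight_le_one hp 0
  have h4 := weight_pos hp 0
  rw [theta, abs_le]
  split_ifs <;> constructor <;> linarith

theorem exists_abs_theta_le_of_le_one (hp : 0 < p) (k : ℕ) :
    ∃ C, 0 ≤ C ∧ ∀ u, 0 < u → u ≤ 1 → |theta p k u| ≤ C / u ^ (k + 1) := by
  have hG : 0 < Real.Gamma ((k : ℝ) + 1 / 2) := Real.Gamma_pos_of_pos (by positivity)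
  have hS : 0 ≤ ∑' j, 1 / root p j ^ 2 := tsum_nonneg fun j => by positivity
  refine ⟨(k + 1).factorial * (∑' j, 1 / root p j ^ 2) + Real.Gamma (k + 1 / 2) / 2 + 1,
    by positivity, fun u hu hu1 => (abs_theta_le hp k hu).trans ?_⟩
  rw [add_div, add_div]
  refine add_le_add (add_le_add (rootTheta_le hp k hu) ?_) ?_
  · rw [gaussMoment, div_eq_mul_inv _ (u ^ (k + 1))]
    refine mul_le_mul_of_nonneg_left ?_ (by positivity)
    calc u ^ (-((k : ℝ) + 1 / 2)) ≤ u ^ (-((k + 1 : ℕ) : ℝ)) :=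
          Real.rpow_le_rpow_of_exponent_ge hu hu1 (by push_cast; linarith)
      _ = (u ^ (k + 1))⁻¹ := by rw [Real.rpow_neg hu.le, Real.rpow_natCast]
  · have : 1 ≤ 1 / u ^ (k + 1) := by
      rw [le_div_iff₀ (by positivity), one_mul]
      exact pow_le_one₀ hu.le hu1
    split_ifs <;> linarith

theorem exists_abs_theta_le_of_one_le (hp : 0 < p) (k : ℕ) :
    ∃ C, 0 ≤ C ∧ ∀ u, 1 ≤ u → |theta p k u| ≤ C / u ^ k := by
  have hG : 0 < Real.Gamma ((k : ℝ) + 1 / 2) := Real.Gamma_pos_of_pos (by positivity)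
  have hS : 0 ≤ ∑' j, 1 / root p j ^ 2 := tsum_nonneg fun j => by positivity
  refine ⟨(k + 1).factorial * (∑' j, 1 / root p j ^ 2) + Real.Gamma (k + 1 / 2) / 2 + 1,
    by positivity, fun u hu1 => ?_⟩
  have hu : 0 < u := by linarith
  refine (abs_theta_le hp k hu).trans ?_
  rw [add_div, add_div]
  refine add_le_add (add_le_add ((rootTheta_le hp k hu).trans ?_) ?_) ?_
  · exact div_le_div_of_nonneg_left (by positivity) (by positivity)
      (pow_le_pow_right₀ hu1 (Nat.le_succ k))
  · rw [gaussMoment, div_eq_mul_inv _ (u ^ k)]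
    refine mul_le_mul_of_nonneg_left ?_ (by positivity)
    calc u ^ (-((k : ℝ) + 1 / 2)) ≤ u ^ (-(k : ℝ)) :=
          Real.rpow_le_rpow_of_exponent_le hu1 (by linarith)
      _ = (u ^ k)⁻¹ := by rw [Real.rpow_neg hu.le, Real.rpow_natCast]
  · split_ifs with h
    · simp [h]
    · positivity

/-- Interpolation between derivatives: by the mean value theorem a difference quotient of θ_k over a
very short interval is −θ_{k+1}(ξ), and moving from ξ to u costs the interval length times θ_{k+2},
which has only polynomial growth at 0. -/
theorem theta_flat_succ (hp : 0 < p) (k : ℕ)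
    (ih : ∀ n : ℕ, ∃ C, 0 ≤ C ∧ ∀ u, 0 < u → u ≤ 1 → |theta p k u| ≤ C * u ^ n) (n : ℕ) :
    ∃ C, 0 ≤ C ∧ ∀ u, 0 < u → u ≤ 1 → |theta p (k + 1) u| ≤ C * u ^ n := by
  obtain ⟨M, hM0, hM⟩ := exists_abs_theta_le_of_le_one hp (k + 2)
  -- The interval has length d = u^q/2. The k + 3 in q absorbs the bound M/u^{k+3} for θ_{k+2} and
  -- leaves u^n; flatness of θ_k to order n + q survives division by d. Since d ≤ u/2, the interval
  -- stays in [u/2, u].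
  set q := n + (k + 3) with hq
  obtain ⟨C, hC0, hC⟩ := ih (n + q)
  refine ⟨4 * C + M * 2 ^ (k + 3), by positivity, fun u hu hu1 => ?_⟩
  obtain ⟨d, hd⟩ : ∃ d : ℝ, d = u ^ q / 2 := ⟨_, rfl⟩
  have hdpos : 0 < d := by rw [hd]; positivity
  have hdu : d ≤ u / 2 := by
    have : u ^ q ≤ u ^ 1 := pow_le_pow_of_le_one hu.le hu1 (by omega)
    rw [pow_one] at this
    linarith
  have hcont : ∀ i, ContinuousOn (theta p i) (Icc (u - d) u) := fun i =>
    (continuousOn_theta hp i).mono fun x hx => mem_Ioi.2 (by linarith [hx.1])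
  obtain ⟨ξ, hξ, h1⟩ := exists_hasDerivAt_eq_slope (theta p k) (fun x => -theta p (k + 1) x)
    (show u - d < u by linarith) (hcont k) (fun x hx => hasDerivAt_theta hp k (by linarith [hx.1]))
  obtain ⟨η, hη, h2⟩ := exists_hasDerivAt_eq_slope (theta p (k + 1)) (fun x => -theta p (k + 2) x)
    hξ.2 ((hcont (k + 1)).mono (Icc_subset_Icc_left hξ.1.le))
    (fun x hx => hasDerivAt_theta hp (k + 1) (by linarith [hx.1, hξ.1]))
  have hξu : 0 < u - ξ := by linarith [hξ.2]
  have hξd : u - ξ ≤ d := by linarith [hξ.1]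
  have h3 : |theta p (k + 1) ξ| ≤ 4 * C * u ^ n := by
    have hudpos : 0 < u - d := by linarith
    have a1 := hC u hu hu1
    have a2 : |theta p k (u - d)| ≤ C * u ^ (n + q) := by
      refine (hC (u - d) hudpos (by linarith)).trans ?_
      have : u - d ≤ u := by linarith
      gcongr
    have a3 : |theta p k u - theta p k (u - d)| ≤ 2 * (C * u ^ (n + q)) :=
      (abs_sub _ _).trans (by linarith)
    have a4 : |theta p (k + 1) ξ| = |theta p k u - theta p k (u - d)| / d := by
      have := congrArg abs h1
      rwa [abs_neg, abs_div, sub_sub_cancel, abs_of_pos hdpos] at this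
    rw [a4, div_le_iff₀ hdpos]
    refine a3.trans (le_of_eq ?_)
    rw [hd, pow_add]
    ring
  have h4 : |theta p (k + 1) u - theta p (k + 1) ξ| ≤ M * 2 ^ (k + 3) * u ^ n := by
    have b1 : |theta p (k + 1) u - theta p (k + 1) ξ| = |theta p (k + 2) η| * (u - ξ) := by
      have := congrArg abs h2
      rw [abs_neg, abs_div, abs_of_pos hξu] at this
      rw [this, div_mul_cancel₀ _ hξu.ne']
    have hηu : u / 2 ≤ η := by linarith [hη.1, hξ.1]
    have b2 := hM η (by linarith) (by linarith [hη.2])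
    have b3 : M / η ^ (k + 2 + 1) ≤ M / (u / 2) ^ (k + 3) :=
      div_le_div_of_nonneg_left hM0 (by positivity) (pow_le_pow_left₀ (by positivity) hηu _)
    rw [b1]
    calc |theta p (k + 2) η| * (u - ξ) ≤ M / (u / 2) ^ (k + 3) * d :=
          mul_le_mul (b2.trans b3) hξd hξu.le (by positivity)
      _ = M * 2 ^ (k + 3) * u ^ n / 2 := by
          rw [hd, hq, div_pow, pow_add u n]
          field_simp
      _ ≤ M * 2 ^ (k + 3) * u ^ n := by
          have : 0 ≤ M * 2 ^ (k + 3) * u ^ n := by positivity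
          linarith
  have h5 := abs_add_le (theta p (k + 1) u - theta p (k + 1) ξ) (theta p (k + 1) ξ)
  rw [sub_add_cancel] at h5
  linarith

theorem theta_flat_of_le_one (hp : 0 < p) (k : ℕ) :
    ∀ n : ℕ, ∃ C, 0 ≤ C ∧ ∀ u, 0 < u → u ≤ 1 → |theta p k u| ≤ C * u ^ n := by
  induction k with
  | zero =>
    intro n
    refine ⟨√Real.pi * 2 ^ n * n.factorial, by positivity, fun u hu hu1 => ?_⟩
    refine (abs_theta_zero_le hp n hu).trans ?_
    exact mul_le_of_le_one_right (by positivity) (Real.sqrt_le_one.2 hu1)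
  | succ k ih => exact theta_flat_succ hp k ih

/-- Flatness for u ≤ 1, boundedness for u ≥ 1. -/
theorem exists_abs_theta_le_mul_pow (hp : 0 < p) (k n : ℕ) :
    ∃ C, 0 ≤ C ∧ ∀ u, 0 < u → |theta p k u| ≤ C * u ^ n := by
  obtain ⟨C₁, h1, hC₁⟩ := theta_flat_of_le_one hp k n
  obtain ⟨C₂, h2, hC₂⟩ := exists_abs_theta_le_of_one_le hp k
  refine ⟨C₁ + C₂, by positivity, fun u hu => ?_⟩
  rcases le_total u 1 with h | h
  · refine (hC₁ u hu h).trans ?_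
    gcongr
    linarith
  · refine (hC₂ u h).trans ((div_le_self h2 (one_le_pow₀ h)).trans ?_)
    nlinarith [one_le_pow₀ h (n := n)]

theorem exists_abs_theta_le_div_pow (hp : 0 < p) (k : ℕ) :
    ∃ C, 0 ≤ C ∧ ∀ u, 0 < u → |theta p k u| ≤ C / u ^ k := by
  obtain ⟨C₁, h1, hC₁⟩ := theta_flat_of_le_one hp k 0
  obtain ⟨C₂, h2, hC₂⟩ := exists_abs_theta_le_of_one_le hp k
  refine ⟨C₁ + C₂, by positivity, fun u hu => ?_⟩
  rcases le_total u 1 with h | h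
  · refine (hC₁ u hu h).trans ?_
    rw [pow_zero, mul_one, le_div_iff₀ (by positivity)]
    nlinarith [pow_le_one₀ (n := k) hu.le h]
  · refine (hC₂ u h).trans ?_
    gcongr
    linarith

/-! ### Integrals of products of theta functions -/

theorem integrableOn_Ioi_of_abs_le {f : ℝ → ℝ} (hf : ContinuousOn f (Ioi 0)) {C D : ℝ} {n : ℕ}
    (hn : 2 ≤ n) (h0 : ∀ u, 0 < u → |f u| ≤ C) (h1 : ∀ u, 0 < u → |f u| ≤ D / u ^ n) :
    IntegrableOn f (Ioi 0) := by
  rw [← Ioc_union_Ioi_eq_Ioi zero_le_one, integrableOn_union]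
  constructor
  · refine Integrable.mono' (g := fun _ => C) (integrableOn_const (by simp))
      ((hf.mono Ioc_subset_Ioi_self).aestronglyMeasurable measurableSet_Ioc) ?_
    filter_upwards [ae_restrict_mem measurableSet_Ioc] with u hu
    exact h0 u hu.1
  · have hi : IntegrableOn (fun u : ℝ => D * u ^ (-(n : ℝ))) (Ioi 1) :=
      (integrableOn_Ioi_rpow_of_lt (by
        have : (2 : ℝ) ≤ n := by exact_mod_cast hn
        linarith) one_pos).const_mul D
    refine Integrable.mono' hi
      ((hf.mono (Ioi_subset_Ioi zero_le_one)).aestronglyMeasurable measurableSet_Ioi) ?_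
    filter_upwards [ae_restrict_mem measurableSet_Ioi] with u hu
    have hu0 : (0 : ℝ) < u := zero_lt_one.trans hu
    rw [Real.rpow_neg hu0.le, Real.rpow_natCast, ← div_eq_mul_inv]
    exact h1 u hu0

theorem continuousOn_theta_mul (hp : 0 < p) (a b : ℕ) {s : ℝ} (hs : 0 < s) :
    ContinuousOn (fun u => theta p a u * theta p b (s * u)) (Ioi 0) :=
  (continuousOn_theta hp a).mul ((continuousOn_theta hp b).comp (by fun_prop)
    fun u hu => mul_pos hs hu)

theorem exists_abs_theta_mul_le (hp : 0 < p) (a b n : ℕ) {s : ℝ} (hs : 0 < s) :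
    ∃ C, ∀ u, 0 < u → |theta p a u * theta p b (s * u)| ≤ C * u ^ n := by
  obtain ⟨C₁, h1, hC₁⟩ := exists_abs_theta_le_mul_pow hp a n
  obtain ⟨C₂, h2, hC₂⟩ := exists_abs_theta_le_mul_pow hp b 0
  refine ⟨C₁ * C₂, fun u hu => ?_⟩
  rw [abs_mul]
  have := mul_le_mul (hC₁ u hu) (hC₂ (s * u) (by positivity)) (abs_nonneg _) (by positivity)
  rw [pow_zero] at this
  linarith

theorem exists_abs_theta_mul_le_div (hp : 0 < p) (a b : ℕ) {s : ℝ} (hs : 0 < s) :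
    ∃ C, ∀ u, 0 < u → |theta p a u * theta p b (s * u)| ≤ C / u ^ (a + b) := by
  obtain ⟨C₁, h1, hC₁⟩ := exists_abs_theta_le_div_pow hp a
  obtain ⟨C₂, h2, hC₂⟩ := exists_abs_theta_le_div_pow hp b
  refine ⟨C₁ * C₂ / s ^ b, fun u hu => ?_⟩
  rw [abs_mul]
  refine (mul_le_mul (hC₁ u hu) (hC₂ (s * u) (by positivity)) (abs_nonneg _)
    (by positivity)).trans (le_of_eq ?_)
  rw [mul_pow, pow_add]
  field_simp

theorem integrableOn_theta_mul (hp : 0 < p) {a b : ℕ} (hab : 2 ≤ a + b) {s : ℝ} (hs : 0 < s) :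
    IntegrableOn (fun u => theta p a u * theta p b (s * u)) (Ioi 0) := by
  obtain ⟨C, hC⟩ := exists_abs_theta_mul_le hp a b 0 hs
  obtain ⟨D, hD⟩ := exists_abs_theta_mul_le_div hp a b hs
  exact integrableOn_Ioi_of_abs_le (continuousOn_theta_mul hp a b hs) hab
    (fun u hu => by simpa using hC u hu) hD

/-- The boundary term vanishes at 0 by flatness and at infinity because the product is O(u^{−(a+b)})
with a + b ≥ 1. -/
theorem integral_theta_mul_by_parts (hp : 0 < p) {a b : ℕ} (hab : 1 ≤ a + b) {s : ℝ}
    (hs : 0 < s) :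
    ∫ u in Ioi (0 : ℝ), theta p a u * theta p (b + 1) (s * u) =
      -s⁻¹ * ∫ u in Ioi (0 : ℝ), theta p (a + 1) u * theta p b (s * u) := by
  have hd : ∀ u ∈ Ioi (0 : ℝ), HasDerivAt (fun u => theta p b (s * u))
      (-(s * theta p (b + 1) (s * u))) u := by
    intro u hu
    have h1 : HasDerivAt (fun u : ℝ => s * u) s u := by
      simpa using (hasDerivAt_id u).const_mul s
    exact ((hasDerivAt_theta hp b (mul_pos hs hu)).comp u h1).congr_deriv (by ring)
  have hi1 := (integrableOn_theta_mul hp (a := a) (b := b + 1) (by omega) hs).const_mul (-s)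
  have hi2 := (integrableOn_theta_mul hp (a := a + 1) (b := b) (by omega) hs).const_mul (-1)
  have ht0 : Tendsto (fun u => theta p a u * theta p b (s * u)) (𝓝[>] 0) (𝓝 0) := by
    obtain ⟨C, hC⟩ := exists_abs_theta_mul_le hp a b 1 hs
    have hlim : Tendsto (fun u : ℝ => C * u ^ 1) (𝓝[>] 0) (𝓝 0) := by
      have : Continuous fun u : ℝ => C * u ^ 1 := by fun_prop
      simpa using (this.tendsto 0).mono_left nhdsWithin_le_nhds
    refine squeeze_zero_norm' ?_ hlim
    filter_upwards [self_mem_nhdsWithin] with u hu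
    exact hC u hu
  have ht1 : Tendsto (fun u => theta p a u * theta p b (s * u)) atTop (𝓝 0) := by
    obtain ⟨D, hD⟩ := exists_abs_theta_mul_le_div hp a b hs
    have hlim : Tendsto (fun u : ℝ => D / u ^ (a + b)) atTop (𝓝 0) :=
      tendsto_const_nhds.div_atTop (tendsto_pow_atTop (by omega))
    refine squeeze_zero_norm' ?_ hlim
    filter_upwards [eventually_gt_atTop 0] with u hu
    exact hD u hu
  have h := integral_Ioi_mul_deriv_eq_deriv_mul (a := 0) (u := theta p a)
    (v := fun u => theta p b (s * u)) (fun u hu => hasDerivAt_theta hp a hu) hd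
    (hi1.congr (Eventually.of_forall fun u => by simp only [Pi.mul_apply]; ring))
    (hi2.congr (Eventually.of_forall fun u => by simp only [Pi.mul_apply]; ring)) ht0 ht1
  have e1 : ∀ u : ℝ, theta p a u * -(s * theta p (b + 1) (s * u)) =
      -s * (theta p a u * theta p (b + 1) (s * u)) := fun u => by ring
  simp only [e1, neg_mul, integral_neg, integral_const_mul] at h
  rw [neg_mul, eq_neg_iff_add_eq_zero]
  field_simp
  linarith

/-- All m + 1 derivatives pass from the second factor to the first, each costing −1/s; the
substitution u ↦ u/s then restores the original shape with s inverted. -/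
theorem integral_theta_mul_swap (hp : 0 < p) {m : ℕ} (hm : 1 ≤ m) {s : ℝ} (hs : 0 < s) :
    ∫ u in Ioi (0 : ℝ), theta p 0 u * theta p (m + 1) (s * u) =
      (-s⁻¹) ^ (m + 1) * (s⁻¹ * ∫ u in Ioi (0 : ℝ), theta p 0 u * theta p (m + 1) (s⁻¹ * u)) := by
  have key : ∀ i ≤ m + 1, ∫ u in Ioi (0 : ℝ), theta p 0 u * theta p (m + 1) (s * u) =
      (-s⁻¹) ^ i * ∫ u in Ioi (0 : ℝ), theta p i u * theta p (m + 1 - i) (s * u) := by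
    intro i
    induction i with
    | zero => simp
    | succ i ih =>
      intro hi
      rw [ih (by omega), show m + 1 - i = (m + 1 - (i + 1)) + 1 by omega,
        -- The two orders entering this step always add up to m, so m ≥ 1 is what it requires.
        integral_theta_mul_by_parts hp (by omega) hs, pow_succ, mul_assoc]
  rw [key (m + 1) le_rfl, Nat.sub_self]
  congr 1
  have h := integral_comp_mul_left_Ioi
    (fun u => theta p (m + 1) (s⁻¹ * u) * theta p 0 u) 0 hs
  simp only [mul_zero, inv_mul_cancel_left₀ hs.ne', smul_eq_mul] at h
  rw [h]
  simp only [mul_comm]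

/-! ### The Laplace transform of the theta function -/

/-- The kernel `ψ` on the positive real axis. -/
noncomputable def psiReal (p x : ℝ) : ℝ :=
  (p - x) / ((p + x) * Real.exp (2 * Real.pi * x) - (p - x))

theorem psiReal_den_pos (hp : 0 < p) {x : ℝ} (hx : 0 < x) :
    0 < (p + x) * Real.exp (2 * Real.pi * x) - (p - x) := by
  have h : 1 ≤ Real.exp (2 * Real.pi * x) := Real.one_le_exp (by have := Real.pi_pos; positivity)
  nlinarith

theorem psi_ofReal (hp : 0 < p) {x : ℝ} (hx : 0 < x) : psi p x = psiReal p x := by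
  have hd : den p x ≠ 0 := den_ne_zero_of_re_pos hp (by simpa using hx)
  have h1 : ((p + x : ℂ) * Complex.exp (2 * Real.pi * x) - (p - x)) ≠ 0 := by
    exact_mod_cast (psiReal_den_pos hp hx).ne'
  have he : Complex.exp (2 * Real.pi * x) = Complex.exp (Real.pi * x) * Complex.exp (Real.pi * x) := by
    rw [← Complex.exp_add]; ring_nf
  have he2 : Complex.exp (Real.pi * x) * Complex.exp (-(Real.pi * x)) = 1 := by
    rw [← Complex.exp_add, add_neg_cancel, Complex.exp_zero]
  rw [psiReal, psi]
  push_cast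
  rw [div_sub_div _ _ (by simpa using hd) two_ne_zero, div_eq_div_iff (by simpa using hd) h1, he,
    num_eq, den_eq]
  linear_combination 2 * (p - x : ℂ) * (p + x) * Complex.exp (Real.pi * x) * he2

theorem hasSum_partialFractions_real (hp : 0 < p) {x : ℝ} (hx : 0 < x) :
    HasSum (fun j => koshliakovWeight p (root p j) * (1 / (x ^ 2 + root p j ^ 2)))
      (Real.pi / x * (psiReal p x + 1 / 2) - koshliakovWeight p 0 / (2 * x ^ 2)) := by
  have h := hasSum_partialFractions hp (z := (x : ℂ)) (by simpa using hx)
  have e : num p x / (2 * den p x) = ((psiReal p x + 1 / 2 : ℝ) : ℂ) := by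
    push_cast
    rw [← psi_ofReal hp hx, psi]
    ring
  rw [e] at h
  have h2 : HasSum (fun j => koshliakovWeight p (root p j) * (x / (x ^ 2 + root p j ^ 2)))
      (Real.pi * (psiReal p x + 1 / 2) - koshliakovWeight p 0 / (2 * x)) := by
    rw [← Complex.hasSum_ofReal]
    push_cast at h ⊢
    exact h
  have h3 := h2.mul_left (1 / x)
  have e3 : 1 / x * (Real.pi * (psiReal p x + 1 / 2) - koshliakovWeight p 0 / (2 * x)) =
      Real.pi / x * (psiReal p x + 1 / 2) - koshliakovWeight p 0 / (2 * x ^ 2) := by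
    field_simp
  rw [e3] at h3
  refine h3.congr_fun fun j => ?_
  field_simp

theorem integral_exp_neg_mul_Ioi {r : ℝ} (hr : 0 < r) :
    ∫ u in Ioi (0 : ℝ), Real.exp (-r * u) = 1 / r := by
  have h := Real.integral_rpow_mul_exp_neg_mul_Ioi (a := 1) one_pos hr
  simpa using h

/-- Everything is positive, so the interchange needs only summability of the integrals, which the
partial fractions supply. -/
theorem hasSum_integral_exp_mul_rootTheta (hp : 0 < p) {x : ℝ} (hx : 0 < x) :
    HasSum (fun j => koshliakovWeight p (root p j) * (1 / (x ^ 2 + root p j ^ 2)))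
      (∫ u in Ioi (0 : ℝ), Real.exp (-x ^ 2 * u) * rootTheta p 0 u) := by
  have hr : ∀ j, 0 < x ^ 2 + root p j ^ 2 := fun j => by positivity
  set F : ℕ → ℝ → ℝ := fun j u =>
    koshliakovWeight p (root p j) * Real.exp (-(x ^ 2 + root p j ^ 2) * u) with hF
  have hFint : ∀ j, IntegrableOn (F j) (Ioi 0) := fun j =>
    (exp_neg_integrableOn_Ioi 0 (hr j)).const_mul _
  have hFval : ∀ j, ∫ u in Ioi (0 : ℝ), F j u =
      koshliakovWeight p (root p j) * (1 / (x ^ 2 + root p j ^ 2)) := by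
    intro j
    rw [hF]
    simp only
    rw [integral_const_mul, integral_exp_neg_mul_Ioi (hr j)]
  have hFnn : ∀ j u, ‖F j u‖ = F j u := fun j u =>
    Real.norm_of_nonneg (mul_nonneg (weight_pos hp _).le (Real.exp_pos _).le)
  have hs : Summable fun j => ∫ u in Ioi (0 : ℝ), ‖F j u‖ := by
    simp only [hFnn, hFval]
    exact (hasSum_partialFractions_real hp hx).summable
  have hsum : ∀ u ∈ Ioi (0 : ℝ), HasSum (fun j => F j u) (Real.exp (-x ^ 2 * u) * rootTheta p 0 u) := by
    intro u hu
    refine ((hasSum_rootTheta hp 0 hu).mul_left (Real.exp (-x ^ 2 * u))).congr_fun fun j => ?_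
    rw [hF]
    simp only
    rw [show -(x ^ 2 + root p j ^ 2) * u = -x ^ 2 * u + -u * root p j ^ 2 by ring, Real.exp_add]
    ring
  have e : EqOn (fun u => ∑' j, F j u) (fun u => Real.exp (-x ^ 2 * u) * rootTheta p 0 u)
      (Ioi 0) := fun u hu => (hsum u hu).tsum_eq
  have h := hasSum_integral_of_summable_integral_norm hFint hs
  rw [setIntegral_congr_fun measurableSet_Ioi e] at h
  simpa only [hFval] using h

/-- The partial fractions give the transform of the root sum; the terms π/(2x) and w(0)/(2x²) in it
are exactly cancelled by the transforms of the Gaussian term and of the constant. -/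
theorem integral_exp_mul_theta (hp : 0 < p) {x : ℝ} (hx : 0 < x) :
    ∫ u in Ioi (0 : ℝ), Real.exp (-x ^ 2 * u) * theta p 0 u = Real.pi / x * psiReal p x := by
  have hx2 : 0 < x ^ 2 := by positivity
  have hpi := Real.pi_pos
  have hAv := (hasSum_integral_exp_mul_rootTheta hp hx).unique (hasSum_partialFractions_real hp hx)
  have hB : ∫ u in Ioi (0 : ℝ), Real.exp (-x ^ 2 * u) * gaussMoment 0 u = Real.pi / (2 * x) := by
    have h := Real.integral_rpow_mul_exp_neg_mul_Ioi (a := 1 / 2) (by norm_num) hx2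
    have e : ∀ u : ℝ, Real.exp (-x ^ 2 * u) * gaussMoment 0 u =
        √Real.pi / 2 * (u ^ ((1 : ℝ) / 2 - 1) * Real.exp (-(x ^ 2 * u))) := by
      intro u
      rw [gaussMoment, Nat.cast_zero, zero_add, Real.Gamma_one_half_eq, neg_mul]
      norm_num
      ring
    simp only [e]
    rw [integral_const_mul, h, Real.Gamma_one_half_eq, ← Real.sqrt_eq_rpow,
      Real.sqrt_div zero_le_one, Real.sqrt_one, Real.sqrt_sq hx.le]
    have : √Real.pi * √Real.pi = Real.pi := Real.mul_self_sqrt hpi.le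
    field_simp
    linear_combination this
  -- A non-integrable function has integral 0 by convention, whereas this integral is positive.
  have hBi : IntegrableOn (fun u => Real.exp (-x ^ 2 * u) * gaussMoment 0 u) (Ioi 0) := by
    by_contra hcon
    rw [integral_undef hcon] at hB
    have : 0 < Real.pi / (2 * x) := by positivity
    linarith
  have hCi : IntegrableOn (fun u => Real.exp (-x ^ 2 * u) * (koshliakovWeight p 0 / 2)) (Ioi 0) :=
    (exp_neg_integrableOn_Ioi 0 hx2).mul_const _
  have hT : IntegrableOn (fun u => theta p 0 u * Real.exp (-x ^ 2 * u)) (Ioi 0) := by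
    obtain ⟨C, -, hC⟩ := exists_abs_theta_le_mul_pow hp 0 0
    refine Integrable.bdd_mul (c := C) (exp_neg_integrableOn_Ioi 0 hx2)
      ((continuousOn_theta hp 0).aestronglyMeasurable measurableSet_Ioi) ?_
    filter_upwards [ae_restrict_mem measurableSet_Ioi] with u hu
    simpa using hC u hu
  have hA : IntegrableOn (fun u => Real.exp (-x ^ 2 * u) * rootTheta p 0 u) (Ioi 0) := by
    refine ((hT.add hBi).sub hCi).congr (Eventually.of_forall fun u => ?_)
    simp only [Pi.add_apply, Pi.sub_apply]
    rw [theta, if_pos rfl]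
    ring
  have e : ∀ u : ℝ, Real.exp (-x ^ 2 * u) * theta p 0 u = Real.exp (-x ^ 2 * u) * rootTheta p 0 u -
      Real.exp (-x ^ 2 * u) * gaussMoment 0 u +
      Real.exp (-x ^ 2 * u) * (koshliakovWeight p 0 / 2) := by
    intro u
    rw [theta, if_pos rfl]
    ring
  simp only [e]
  have hAB : IntegrableOn (fun u => Real.exp (-x ^ 2 * u) * rootTheta p 0 u -
      Real.exp (-x ^ 2 * u) * gaussMoment 0 u) (Ioi 0) := hA.sub hBi
  rw [integral_add hAB hCi, integral_sub hA hBi, hAv, hB, integral_mul_const,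
    integral_exp_neg_mul_Ioi hx2]
  field_simp
  ring

/-! ### The Lambert-type series -/

/-- The Mellin-type moment `∫_0^∞ θ(u) u^{-m-3/2} du`. -/
noncomputable def thetaMoment (p : ℝ) (m : ℕ) : ℝ :=
  ∫ u in Ioi (0 : ℝ), theta p 0 u * u ^ (-((m : ℝ) + 3 / 2))

theorem integrableOn_theta_mul_rpow (hp : 0 < p) {m : ℕ} (hm : 1 ≤ m) :
    IntegrableOn (fun u => theta p 0 u * u ^ (-((m : ℝ) + 3 / 2))) (Ioi 0) := by
  obtain ⟨C, hC0, hC⟩ := exists_abs_theta_le_mul_pow hp 0 (m + 2)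
  obtain ⟨D, hD0, hD⟩ := exists_abs_theta_le_div_pow hp 0
  have hr : ∀ u : ℝ, 0 < u → u ≤ 1 → u ^ (-((m : ℝ) + 3 / 2)) ≤ (u ^ (m + 2))⁻¹ := by
    intro u hu hu1
    rw [← Real.rpow_natCast, ← Real.rpow_neg hu.le]
    exact Real.rpow_le_rpow_of_exponent_ge hu hu1 (by push_cast; linarith)
  have hr' : ∀ u : ℝ, 1 ≤ u → u ^ (-((m : ℝ) + 3 / 2)) ≤ (u ^ (m + 1))⁻¹ := by
    intro u hu1
    rw [← Real.rpow_natCast, ← Real.rpow_neg (by linarith)]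
    exact Real.rpow_le_rpow_of_exponent_le hu1 (by push_cast; linarith)
  have habs : ∀ u : ℝ, 0 < u → |theta p 0 u * u ^ (-((m : ℝ) + 3 / 2))| =
      |theta p 0 u| * u ^ (-((m : ℝ) + 3 / 2)) := by
    intro u hu
    rw [abs_mul, abs_of_pos (Real.rpow_pos_of_pos hu _)]
  have hle : ∀ u : ℝ, 0 < u → u ≤ 1 →
      |theta p 0 u * u ^ (-((m : ℝ) + 3 / 2))| ≤ C := by
    intro u hu h
    rw [habs u hu]
    refine (mul_le_mul (hC u hu) (hr u hu h) (Real.rpow_pos_of_pos hu _).le (by positivity)).trans ?_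
    rw [mul_assoc, mul_inv_cancel₀ (by positivity), mul_one]
  have hge : ∀ u : ℝ, 1 ≤ u →
      |theta p 0 u * u ^ (-((m : ℝ) + 3 / 2))| ≤ D / u ^ (m + 1) := by
    intro u h
    have hu : 0 < u := by linarith
    rw [habs u hu, div_eq_mul_inv]
    have := hD u hu
    rw [pow_zero, div_one] at this
    exact mul_le_mul this (hr' u h) (Real.rpow_pos_of_pos hu _).le hD0
  refine integrableOn_Ioi_of_abs_le (C := C + D) (D := C + D) (n := m + 1) ?_ (by omega) ?_ ?_
  · exact (continuousOn_theta hp 0).mul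
      (continuousOn_id.rpow_const fun u hu => Or.inl (ne_of_gt hu))
  · intro u hu
    rcases le_total u 1 with h | h
    · exact (hle u hu h).trans (by linarith)
    · refine (hge u h).trans ((div_le_self hD0 (one_le_pow₀ h)).trans (by linarith))
  · intro u hu
    rcases le_total u 1 with h | h
    · refine (hle u hu h).trans ?_
      rw [le_div_iff₀ (by positivity)]
      have := pow_le_one₀ (n := m + 1) hu.le h
      nlinarith
    · refine (hge u h).trans ?_
      gcongr
      linarith

theorem integrableOn_theta_mul_rootTheta (hp : 0 < p) (k : ℕ) {s : ℝ} (hs : 0 < s) (hk : 1 ≤ k) :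
    IntegrableOn (fun u => theta p 0 u * rootTheta p k (s * u)) (Ioi 0) := by
  obtain ⟨C, hC0, hC⟩ := exists_abs_theta_le_mul_pow hp 0 (k + 1)
  obtain ⟨D, hD0, hD⟩ := exists_abs_theta_le_div_pow hp 0
  obtain ⟨S, hS⟩ : ∃ S : ℝ, S = (k + 1).factorial * (∑' j, 1 / root p j ^ 2) := ⟨_, rfl⟩
  have hS0 : 0 ≤ S := by
    have : 0 ≤ ∑' j, 1 / root p j ^ 2 := tsum_nonneg fun j => by positivity
    rw [hS]; positivity
  have hb : ∀ u : ℝ, 0 < u → |rootTheta p k (s * u)| ≤ S / (s * u) ^ (k + 1) := by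
    intro u hu
    rw [abs_of_nonneg (rootTheta_nonneg hp k _), hS]
    exact rootTheta_le hp k (mul_pos hs hu)
  refine integrableOn_Ioi_of_abs_le (C := C * S / s ^ (k + 1)) (D := D * S / s ^ (k + 1))
    (n := k + 1) ?_ (by omega) ?_ ?_
  · exact (continuousOn_theta hp 0).mul ((continuousOn_rootTheta hp k).comp (by fun_prop)
      fun u hu => mul_pos hs hu)
  · intro u hu
    rw [abs_mul]
    refine (mul_le_mul (hC u hu) (hb u hu) (abs_nonneg _) (by positivity)).trans (le_of_eq ?_)
    rw [mul_pow]
    field_simp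
  · intro u hu
    rw [abs_mul]
    refine (mul_le_mul (hD u hu) (hb u hu) (abs_nonneg _) (by positivity)).trans (le_of_eq ?_)
    rw [mul_pow, pow_zero]
    field_simp

/-- Insert the Laplace formula at x = λ_j t and sum under the integral; its factor 1/x raises the
power of λ_j from 2m + 1 to 2m + 2. -/
theorem hasSum_weight_mul_psiReal (hp : 0 < p) (m : ℕ) {t : ℝ} (ht : 0 < t) :
    HasSum (fun j => koshliakovWeight p (root p j) *
        (root p j ^ (2 * m + 1) * psiReal p (root p j * t)))
      (t / Real.pi * ∫ u in Ioi (0 : ℝ), theta p 0 u * rootTheta p (m + 1) (t ^ 2 * u)) := by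
  have ht2 : 0 < t ^ 2 := by positivity
  have hint := integrableOn_theta_mul_rootTheta hp (m + 1) ht2 (by omega)
  have h := hasSum_integral_of_dominated_convergence (μ := volume.restrict (Ioi 0))
    (F := fun (j : ℕ) (u : ℝ) => theta p 0 u * (koshliakovWeight p (root p j) *
      root p j ^ (2 * (m + 1)) * Real.exp (-(t ^ 2 * u) * root p j ^ 2)))
    (f := fun u => theta p 0 u * rootTheta p (m + 1) (t ^ 2 * u))
    (fun (j : ℕ) (u : ℝ) => |theta p 0 u| * (koshliakovWeight p (root p j) *
      root p j ^ (2 * (m + 1)) * Real.exp (-(t ^ 2 * u) * root p j ^ 2)))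
    (fun j => ((continuousOn_theta hp 0).mul (by fun_prop)).aestronglyMeasurable measurableSet_Ioi)
    (fun j => Eventually.of_forall fun u => by
      rw [norm_mul, Real.norm_eq_abs,
        Real.norm_of_nonneg (rootTheta_term_nonneg hp (m + 1) (t ^ 2 * u) j)])
    ((ae_restrict_mem measurableSet_Ioi).mono fun u hu =>
      (hasSum_rootTheta hp (m + 1) (mul_pos ht2 hu)).summable.mul_left _)
    (by
      refine (hint.norm).congr (Eventually.of_forall fun u => ?_)
      simp only [tsum_mul_left]
      rw [norm_mul, Real.norm_eq_abs, Real.norm_of_nonneg (rootTheta_nonneg hp _ _), rootTheta])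
    ((ae_restrict_mem measurableSet_Ioi).mono fun u hu =>
      (hasSum_rootTheta hp (m + 1) (mul_pos ht2 hu)).mul_left _)
  refine (h.mul_left (t / Real.pi)).congr_fun fun j => ?_
  have hr := root_pos hp j
  have hpi := Real.pi_pos
  have e : ∀ u : ℝ, theta p 0 u * (koshliakovWeight p (root p j) *
      root p j ^ (2 * (m + 1)) * Real.exp (-(t ^ 2 * u) * root p j ^ 2)) =
      koshliakovWeight p (root p j) * root p j ^ (2 * (m + 1)) *
        (Real.exp (-(root p j * t) ^ 2 * u) * theta p 0 u) := by
    intro u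
    rw [show -(t ^ 2 * u) * root p j ^ 2 = -(root p j * t) ^ 2 * u by ring]
    ring
  simp only [e]
  rw [integral_const_mul, integral_exp_mul_theta hp (mul_pos hr ht),
    show 2 * (m + 1) = 2 * m + 1 + 1 by ring, pow_succ _ (2 * m + 1)]
  field_simp

/-- The root sum of order m + 1 is `theta` plus its Gaussian moment, a pure power of t²u; the power
integrates against θ to a Mellin moment. -/
theorem hasSum_weight_mul_psiReal' (hp : 0 < p) {m : ℕ} (hm : 1 ≤ m) {t : ℝ} (ht : 0 < t) :
    HasSum (fun j => koshliakovWeight p (root p j) *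
        (root p j ^ (2 * m + 1) * psiReal p (root p j * t)))
      (t / Real.pi * (∫ u in Ioi (0 : ℝ), theta p 0 u * theta p (m + 1) (t ^ 2 * u)) +
        Real.Gamma (m + 3 / 2) / (2 * Real.pi) * thetaMoment p m / t ^ (2 * m + 2)) := by
  have ht2 : 0 < t ^ 2 := by positivity
  have hpi := Real.pi_pos
  convert hasSum_weight_mul_psiReal hp m ht using 1
  have e : ∀ u ∈ Ioi (0 : ℝ), theta p 0 u * rootTheta p (m + 1) (t ^ 2 * u) =
      theta p 0 u * theta p (m + 1) (t ^ 2 * u) +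
      Real.Gamma (m + 3 / 2) / 2 / t ^ (2 * m + 3) *
        (theta p 0 u * u ^ (-((m : ℝ) + 3 / 2))) := by
    intro u hu
    have hu' : 0 < u := hu
    have e1 : ((m + 1 : ℕ) : ℝ) + 1 / 2 = m + 3 / 2 := by push_cast; ring
    have e2 : (t ^ 2 * u) ^ (-((m : ℝ) + 3 / 2)) = (t ^ (2 * m + 3))⁻¹ * u ^ (-((m : ℝ) + 3 / 2)) := by
      rw [Real.mul_rpow ht2.le hu'.le]
      congr 1
      rw [← Real.rpow_natCast, ← Real.rpow_mul ht.le, ← Real.rpow_natCast, ← Real.rpow_neg ht.le]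
      congr 1
      push_cast
      ring
    rw [theta.eq_1 p (m + 1), if_neg (Nat.succ_ne_zero m), gaussMoment, e1, e2]
    ring
  rw [setIntegral_congr_fun measurableSet_Ioi e,
    integral_add (integrableOn_theta_mul hp (by omega) ht2)
      ((integrableOn_theta_mul_rpow hp hm).const_mul _), integral_const_mul, ← thetaMoment,
    show 2 * m + 3 = 2 * m + 2 + 1 by ring, pow_succ _ (2 * m + 2)]
  field_simp

theorem koshliakovTerm_eq (hp : 0 < p) (m : ℕ) {a x : ℝ} (ha : 0 < a) (hx : 0 < x) :
    koshliakovTerm p a m x =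
      koshliakovWeight p x * (x ^ (2 * m + 1) * psiReal p (x * (a / Real.pi))) := by
  have hpi := Real.pi_pos
  obtain ⟨y, hy⟩ : ∃ y, y = x * (a / Real.pi) := ⟨_, rfl⟩
  have hy0 : 0 < y := by rw [hy]; positivity
  have hd := psiReal_den_pos hp hy0
  have e : x * a / Real.pi = y := by rw [hy]; ring
  have e2 : 2 * a * x = 2 * Real.pi * y := by rw [hy]; field_simp
  rw [koshliakovTerm, e, ← hy, psiReal, koshliakovSigma, e2]
  split_ifs with h
  -- At the pole of σ the cleared numerator p − y is 0, in agreement with the limiting value.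
  · rw [h]; simp
  · have h1 : p - y ≠ 0 := sub_ne_zero.2 (Ne.symm h)
    have h2 : (p + y) / (p - y) * Real.exp (2 * Real.pi * y) - 1 =
        ((p + y) * Real.exp (2 * Real.pi * y) - (p - y)) / (p - y) := by
      field_simp
    rw [h2, div_div_eq_mul_div, mul_div_assoc]

/-! ### Analytic continuation of the zeta function -/

/-- `∑ w_j e^{-u λ_j²}` with its singular part at the origin removed on `(0, 1]`. -/
noncomputable def modifiedTheta (p : ℝ) (u : ℝ) : ℂ :=
  rootTheta p 0 u - (√Real.pi / 2 : ℝ) • (Ioc (0 : ℝ) 1).indicator (fun t : ℝ => (t : ℂ) ^ (-1 / 2 : ℂ)) u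
    + (koshliakovWeight p 0 / 2 : ℝ) • (Ioc (0 : ℝ) 1).indicator (fun _ => (1 : ℂ)) u

theorem ofReal_gaussMoment_zero {u : ℝ} (hu : 0 < u) :
    (gaussMoment 0 u : ℂ) = (√Real.pi / 2 : ℝ) * (u : ℂ) ^ (-1 / 2 : ℂ) := by
  rw [gaussMoment, Nat.cast_zero, zero_add, Real.Gamma_one_half_eq, Complex.ofReal_mul,
    Complex.ofReal_cpow hu.le]
  congr 2
  push_cast
  ring

theorem modifiedTheta_of_le_one {u : ℝ} (hu : 0 < u) (h : u ≤ 1) :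
    modifiedTheta p u = theta p 0 u := by
  have hmem : u ∈ Ioc (0 : ℝ) 1 := ⟨hu, h⟩
  rw [modifiedTheta, indicator_of_mem hmem, indicator_of_mem hmem, theta, if_pos rfl,
    Complex.ofReal_add, Complex.ofReal_sub, ofReal_gaussMoment_zero hu, Complex.real_smul,
    Complex.real_smul, mul_one]

theorem modifiedTheta_of_one_lt {u : ℝ} (h : 1 < u) : modifiedTheta p u = rootTheta p 0 u := by
  have hmem : u ∉ Ioc (0 : ℝ) 1 := fun h' => absurd h'.2 (not_le.2 h)
  rw [modifiedTheta, indicator_of_notMem hmem, indicator_of_notMem hmem]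
  simp

/-- Since 4λ_j² ≥ 1, n spare factors λ_j^{−2} can be replaced by 4^n, which gives decay of any order
at infinity. -/
theorem rootTheta_zero_le (hp : 0 < p) (n : ℕ) {u : ℝ} (hu : 0 < u) :
    rootTheta p 0 u ≤ (n + 1).factorial * 4 ^ n * (∑' j, 1 / root p j ^ 2) / u ^ (n + 1) := by
  rw [mul_div_right_comm, ← tsum_mul_left]
  refine (hasSum_rootTheta hp 0 hu).summable.tsum_le_tsum (fun j => ?_)
    ((summable_one_div_root_sq hp).mul_left _)
  have hr := root_pos hp j
  have h1 := exp_neg_le_factorial_div_pow (n := n + 1) (v := u * root p j ^ 2) (by positivity)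
  have h2 : 1 ≤ 4 * root p j ^ 2 := by nlinarith [half_le_root hp j]
  rw [mul_zero, pow_zero, mul_one]
  calc koshliakovWeight p (root p j) * Real.exp (-u * root p j ^ 2)
      ≤ 1 * ((n + 1).factorial / (u * root p j ^ 2) ^ (n + 1)) := by
        rw [← neg_mul] at h1
        have := weight_le_one hp (root p j)
        gcongr
    _ = (n + 1).factorial / (u ^ (n + 1) * root p j ^ 2 * (root p j ^ 2) ^ n) := by
        rw [one_mul, mul_pow, pow_succ (root p j ^ 2)]
        ring_nf
    _ = (n + 1).factorial * 4 ^ n / (u ^ (n + 1) * root p j ^ 2 * (4 * root p j ^ 2) ^ n) := by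
        rw [mul_pow]
        field_simp
    _ ≤ (n + 1).factorial * 4 ^ n / (u ^ (n + 1) * root p j ^ 2 * 1) := by
        gcongr
        exact one_le_pow₀ h2
    _ = _ := by field_simp

theorem modifiedTheta_isBigO_atTop (hp : 0 < p) (a : ℝ) :
    modifiedTheta p =O[atTop] fun x : ℝ => x ^ (-a) := by
  obtain ⟨n, hn⟩ := exists_nat_ge a
  refine Asymptotics.IsBigO.of_bound ((n + 1).factorial * 4 ^ n * (∑' j, 1 / root p j ^ 2)) ?_
  filter_upwards [eventually_gt_atTop 1] with u hu
  have hu0 : 0 < u := by linarith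
  rw [modifiedTheta_of_one_lt hu, Complex.norm_real,
    Real.norm_of_nonneg (rootTheta_nonneg hp 0 u),
    Real.norm_of_nonneg (Real.rpow_nonneg hu0.le _)]
  refine (rootTheta_zero_le hp n hu0).trans ?_
  rw [div_eq_mul_inv]
  have hS : 0 ≤ ∑' j, 1 / root p j ^ 2 := tsum_nonneg fun j => by positivity
  refine mul_le_mul_of_nonneg_left ?_ (by positivity)
  rw [← Real.rpow_natCast, ← Real.rpow_neg hu0.le]
  exact Real.rpow_le_rpow_of_exponent_le hu.le (by push_cast; linarith)

theorem modifiedTheta_isBigO_zero (hp : 0 < p) (b : ℝ) :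
    modifiedTheta p =O[𝓝[>] 0] fun x : ℝ => x ^ (-b) := by
  obtain ⟨n, hn⟩ := exists_nat_ge (-b)
  obtain ⟨C, hC0, hC⟩ := exists_abs_theta_le_mul_pow hp 0 n
  refine Asymptotics.IsBigO.of_bound C ?_
  filter_upwards [Ioc_mem_nhdsGT one_pos] with u hu
  rw [modifiedTheta_of_le_one hu.1 hu.2, Complex.norm_real, Real.norm_eq_abs,
    Real.norm_of_nonneg (Real.rpow_nonneg hu.1.le _)]
  refine (hC u hu.1).trans (mul_le_mul_of_nonneg_left ?_ hC0)
  rw [← Real.rpow_natCast]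
  exact Real.rpow_le_rpow_of_exponent_ge hu.1 hu.2 hn

theorem hasMellin_singular_half {s : ℂ} (hs : 1 / 2 < s.re) :
    HasMellin ((Ioc (0 : ℝ) 1).indicator fun t : ℝ => (t : ℂ) ^ (-1 / 2 : ℂ)) s
      (1 / (s + -1 / 2)) :=
  hasMellin_cpow_Ioc _ (by
    have : (-1 / 2 : ℂ).re = -1 / 2 := by norm_num
    rw [this]; linarith)

theorem locallyIntegrableOn_of_mellinConvergent_one {f : ℝ → ℂ} (h : MellinConvergent f 1) :
    LocallyIntegrableOn f (Ioi 0) := by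
  rw [MellinConvergent] at h
  simp only [sub_self, Complex.cpow_zero, one_smul] at h
  exact h.locallyIntegrableOn

theorem locallyIntegrableOn_modifiedTheta (hp : 0 < p) :
    LocallyIntegrableOn (modifiedTheta p) (Ioi 0) := by
  have h1 : LocallyIntegrableOn (fun u => (rootTheta p 0 u : ℂ)) (Ioi 0) :=
    ContinuousOn.locallyIntegrableOn
      (Complex.continuous_ofReal.comp_continuousOn (continuousOn_rootTheta hp 0)) measurableSet_Ioi
  have h2 := locallyIntegrableOn_of_mellinConvergent_one (hasMellin_const_smul
    (hasMellin_singular_half (s := 1) (by norm_num)).1 (√Real.pi / 2 : ℝ)).1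
  have h3 := locallyIntegrableOn_of_mellinConvergent_one (hasMellin_const_smul
    (hasMellin_one_Ioc (s := 1) (by simp)).1 (koshliakovWeight p 0 / 2 : ℝ)).1
  have h4 := (h1.sub h2).add h3
  unfold modifiedTheta
  exact h4

theorem mellinConvergent_modifiedTheta (hp : 0 < p) (s : ℂ) :
    MellinConvergent (modifiedTheta p) s :=
  mellinConvergent_of_isBigO_rpow (locallyIntegrableOn_modifiedTheta hp)
    (modifiedTheta_isBigO_atTop hp (s.re + 1)) (by linarith)
    (modifiedTheta_isBigO_zero hp (s.re - 1)) (by linarith)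

/-- The modified function is flat at 0 and decays faster than any power at infinity, so its Mellin
transform is entire. -/
theorem differentiable_mellin_modifiedTheta (hp : 0 < p) :
    Differentiable ℂ (mellin (modifiedTheta p)) := fun s =>
  mellin_differentiableAt_of_isBigO_rpow (locallyIntegrableOn_modifiedTheta hp)
    (modifiedTheta_isBigO_atTop hp (s.re + 1)) (by linarith)
    (modifiedTheta_isBigO_zero hp (s.re - 1)) (by linarith)

/-- The analytic continuation of `∑ w_j λ_j^{-s}` given by the Mellin transform of the theta
function. -/
noncomputable def continuedZeta (p : ℝ) (s : ℂ) : ℂ :=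
  (Complex.Gamma (s / 2))⁻¹ *
    (mellin (modifiedTheta p) (s / 2) + (√Real.pi / 2 : ℝ) * (1 / (s / 2 + -1 / 2))) -
    (koshliakovWeight p 0 / 2 : ℝ) * (Complex.Gamma (s / 2 + 1))⁻¹

/-- The definition uses 1/Γ(s/2 + 1) to stay regular at s = 0; away from 0 the factor 1/Γ(s/2) can
be taken out. -/
theorem continuedZeta_eq {s : ℂ} (hs : s ≠ 0) : continuedZeta p s =
    (Complex.Gamma (s / 2))⁻¹ *
      (mellin (modifiedTheta p) (s / 2) + (√Real.pi / 2 : ℝ) * (1 / (s / 2 + -1 / 2)) -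
        (koshliakovWeight p 0 / 2 : ℝ) * (1 / (s / 2))) := by
  rw [continuedZeta, Complex.Gamma_add_one _ (div_ne_zero hs two_ne_zero), mul_inv]
  ring

theorem differentiableOn_continuedZeta (hp : 0 < p) : DifferentiableOn ℂ (continuedZeta p) {1}ᶜ := by
  intro s hs
  have hs' : s / 2 + -1 / 2 ≠ 0 := by
    intro h
    exact hs (by rw [mem_singleton_iff]; linear_combination 2 * h)
  have h2 : DifferentiableAt ℂ (fun s : ℂ => s / 2) s := by fun_prop
  have hG := Complex.differentiable_one_div_Gamma
  have d1 : DifferentiableAt ℂ (fun s => (Complex.Gamma (s / 2))⁻¹) s :=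
    DifferentiableAt.comp (g := fun z => (Complex.Gamma z)⁻¹) s (hG (s / 2)) h2
  have d2 : DifferentiableAt ℂ (fun s => mellin (modifiedTheta p) (s / 2)) s :=
    DifferentiableAt.comp (g := mellin (modifiedTheta p)) s
      (differentiable_mellin_modifiedTheta hp (s / 2)) h2
  have d3 : DifferentiableAt ℂ (fun s : ℂ => (√Real.pi / 2 : ℝ) * (1 / (s / 2 + -1 / 2))) s :=
    ((differentiableAt_const _).div (h2.add_const _) hs').const_mul _
  have d4 : DifferentiableAt ℂ
      (fun s => (koshliakovWeight p 0 / 2 : ℝ) * (Complex.Gamma (s / 2 + 1))⁻¹) s :=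
    (DifferentiableAt.comp (g := fun z => (Complex.Gamma z)⁻¹) s (hG (s / 2 + 1))
      (h2.add_const 1)).const_mul _
  exact ((d1.mul (d2.add d3)).sub d4).differentiableWithinAt

theorem mellin_rootTheta (hp : 0 < p) {s : ℂ} (hs : 1 / 2 < s.re) :
    mellin (fun u => (rootTheta p 0 u : ℂ)) s =
      mellin (modifiedTheta p) s + (√Real.pi / 2 : ℝ) * (1 / (s + -1 / 2)) -
        (koshliakovWeight p 0 / 2 : ℝ) * (1 / s) := by
  have h2 := hasMellin_singular_half hs
  have h3 := hasMellin_one_Ioc (s := s) (by linarith)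
  have h4 := hasMellin_const_smul h2.1 (√Real.pi / 2 : ℝ)
  have h5 := hasMellin_const_smul h3.1 (koshliakovWeight p 0 / 2 : ℝ)
  have h6 := hasMellin_add (mellinConvergent_modifiedTheta hp s) h4.1
  have h7 := hasMellin_sub h6.1 h5.1
  have e : (fun u => (rootTheta p 0 u : ℂ)) = fun u => modifiedTheta p u +
      (√Real.pi / 2 : ℝ) • (Ioc (0 : ℝ) 1).indicator (fun t : ℝ => (t : ℂ) ^ (-1 / 2 : ℂ)) u -
      (koshliakovWeight p 0 / 2 : ℝ) • (Ioc (0 : ℝ) 1).indicator (fun _ => (1 : ℂ)) u := by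
    funext u
    rw [modifiedTheta]
    abel
  rw [e, h7.2, h6.2, h4.2, h5.2, h2.2, h3.2, Complex.real_smul, Complex.real_smul]

/-- Termwise Mellin transform of ∑ w_j e^{−uλ_j²} at s/2, with frequencies λ_j². -/
theorem hasSum_continuedZeta (hp : 0 < p) {s : ℂ} (hs : 1 < s.re) :
    HasSum (fun j => (koshliakovWeight p (root p j) : ℂ) / (root p j : ℂ) ^ s)
      (continuedZeta p s) := by
  have hs2 : (s / 2).re = s.re / 2 := by simp
  have hs0 : s ≠ 0 := by rintro rfl; norm_num at hs
  have hG : Complex.Gamma (s / 2) ≠ 0 :=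
    Complex.Gamma_ne_zero_of_re_pos (by rw [hs2]; linarith)
  have hsum : Summable fun j => ‖(koshliakovWeight p (root p j) : ℂ)‖ /
      (root p j ^ 2) ^ (s / 2).re := by
    have h1 : Summable fun j : ℕ => 2 ^ s.re * (1 / ((j + 1 : ℕ) : ℝ) ^ s.re) :=
      ((summable_nat_add_iff 1).2 (Real.summable_one_div_nat_rpow.2 hs)).mul_left _
    refine Summable.of_nonneg_of_le (fun j => by have := root_pos hp j; positivity)
      (fun j => ?_) h1
    have hr := root_pos hp j
    have h2 : ((j + 1 : ℕ) : ℝ) / 2 ≤ root p j := by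
      have := lt_root hp j
      have : (0 : ℝ) ≤ j := j.cast_nonneg
      push_cast
      linarith
    have h3 : (root p j ^ 2) ^ (s / 2).re = root p j ^ s.re := by
      rw [hs2, ← Real.rpow_natCast, ← Real.rpow_mul hr.le]
      congr 1
      push_cast
      ring
    rw [h3]
    calc _ ≤ 1 / (((j + 1 : ℕ) : ℝ) / 2) ^ s.re := by
          gcongr
          exact norm_ofReal_weight_le hp _
      _ = _ := by
          rw [Real.div_rpow (by positivity) (by norm_num)]
          field_simp
  have h := hasSum_mellin (s := s / 2) (a := fun j => (koshliakovWeight p (root p j) : ℂ))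
    (p := fun j => root p j ^ 2) (F := fun u => (rootTheta p 0 u : ℂ))
    (fun j => Or.inr (by have := root_pos hp j; positivity)) (by rw [hs2]; linarith)
    (fun u hu => by
      have := Complex.hasSum_ofReal.2 (hasSum_rootTheta hp 0 hu)
      refine this.congr_fun fun j => ?_
      push_cast
      rw [pow_zero, mul_one]
      ring_nf) hsum
  rw [mellin_rootTheta hp (by rw [hs2]; linarith)] at h
  rw [continuedZeta_eq hs0]
  refine (h.mul_left (Complex.Gamma (s / 2))⁻¹).congr_fun fun j => ?_
  have hr := root_pos hp j
  have e : ((root p j ^ 2 : ℝ) : ℂ) ^ (s / 2) = (root p j : ℂ) ^ s := by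
    have h1 : ((root p j ^ 2 : ℝ) : ℂ) = (root p j : ℂ) * (root p j : ℂ) := by push_cast; ring
    have hne : (root p j : ℂ) ≠ 0 := by exact_mod_cast hr.ne'
    rw [h1, Complex.mul_cpow_ofReal_nonneg hr.le hr.le, ← Complex.cpow_add _ _ hne, add_halves]
  rw [e]
  field_simp

theorem isKoshliakovZeta_continuedZeta (hp : 0 < p) : IsKoshliakovZeta p (continuedZeta p) :=
  ⟨differentiableOn_continuedZeta hp, fun _ hs => hasSum_continuedZeta hp hs⟩

theorem isKoshliakovZeta_koshliakovZeta (hp : 0 < p) : IsKoshliakovZeta p (koshliakovZeta p) :=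
  Classical.epsilon_spec ⟨_, isKoshliakovZeta_continuedZeta hp⟩

/-! ### The values at negative odd integers -/

/-- The integral of t^{s−1} over (0,1] for Re s > 0 and minus its integral over (1,∞) for Re s < 0
are both 1/s, and likewise for t^{s−3/2}. Hence for Re s < 0 the continued expression is the Mellin
transform of θ itself. -/
theorem mellin_theta (hp : 0 < p) {s : ℂ} (hs : s.re < 0) :
    mellin (fun u => (theta p 0 u : ℂ)) s =
      mellin (modifiedTheta p) s + (√Real.pi / 2 : ℝ) * (1 / (s + -1 / 2)) -
        (koshliakovWeight p 0 / 2 : ℝ) * (1 / s) := by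
  have hs0 : s ≠ 0 := by rintro rfl; simp at hs
  have hh : (-1 / 2 : ℂ).re = -1 / 2 := by norm_num
  have r1 : (s - 1 + -1 / 2).re < -1 := by
    rw [Complex.add_re, Complex.sub_re, hh, Complex.one_re]; linarith
  have r2 : (s - 1).re < -1 := by rw [Complex.sub_re, Complex.one_re]; linarith
  have i1 := integrableOn_Ioi_cpow_of_lt r1 one_pos
  have i2 := integrableOn_Ioi_cpow_of_lt r2 one_pos
  have v1 := integral_Ioi_cpow_of_lt r1 one_pos
  have v2 := integral_Ioi_cpow_of_lt r2 one_pos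
  set g : ℝ → ℂ := fun t => (√Real.pi / 2 : ℝ) * (t : ℂ) ^ (s - 1 + -1 / 2) -
    (koshliakovWeight p 0 / 2 : ℝ) * (t : ℂ) ^ (s - 1) with hg
  have hgi : IntegrableOn g (Ioi 1) := (i1.const_mul _).sub (i2.const_mul _)
  have hgi' : IntegrableOn ((Ioi (1 : ℝ)).indicator g) (Ioi 0) :=
    (hgi.integrable_indicator measurableSet_Ioi).integrableOn
  have hgv : ∫ t in Ioi (0 : ℝ), (Ioi (1 : ℝ)).indicator g t =
      (√Real.pi / 2 : ℝ) * (-1 / (s + -1 / 2)) - (koshliakovWeight p 0 / 2 : ℝ) * (-1 / s) := by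
    rw [setIntegral_indicator measurableSet_Ioi, Ioi_inter_Ioi, sup_of_le_right zero_le_one, hg,
      integral_sub (i1.const_mul _) (i2.const_mul _), integral_const_mul, integral_const_mul, v1, v2]
    simp only [Complex.ofReal_one, Complex.one_cpow]
    congr 3 <;> ring
  have e : EqOn (fun t : ℝ => (t : ℂ) ^ (s - 1) • (theta p 0 t : ℂ))
      (fun t : ℝ => (t : ℂ) ^ (s - 1) • modifiedTheta p t - (Ioi (1 : ℝ)).indicator g t)
      (Ioi 0) := by
    intro t ht
    have ht0 : (0 : ℝ) < t := ht
    have htc : (t : ℂ) ≠ 0 := by exact_mod_cast ht0.ne'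
    simp only
    rcases le_or_gt t 1 with h | h
    · rw [modifiedTheta_of_le_one ht0 h, indicator_of_notMem (by simpa using h), sub_zero]
    · rw [modifiedTheta_of_one_lt h, indicator_of_mem (mem_Ioi.2 h), hg, theta, if_pos rfl,
        Complex.ofReal_add, Complex.ofReal_sub, ofReal_gaussMoment_zero ht0, smul_eq_mul,
        smul_eq_mul]
      simp only
      rw [Complex.cpow_add _ _ htc]
      ring
  rw [mellin, setIntegral_congr_fun measurableSet_Ioi e,
    integral_sub (mellinConvergent_modifiedTheta hp s) hgi', hgv, ← mellin]
  ring

theorem mellin_theta_eq_thetaMoment (m : ℕ) :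
    mellin (fun u => (theta p 0 u : ℂ)) (-(m : ℂ) - 1 / 2) = thetaMoment p m := by
  rw [mellin, thetaMoment, ← integral_complex_ofReal]
  refine setIntegral_congr_fun measurableSet_Ioi fun t ht => ?_
  have ht0 : (0 : ℝ) < t := ht
  rw [smul_eq_mul, Complex.ofReal_mul, Complex.ofReal_cpow ht0.le, mul_comm]
  congr 2
  push_cast
  ring

/-- Reflection formula, with sin π(−m − 1/2) = (−1)^{m+1}. -/
theorem inv_Gamma_neg_half_sub (m : ℕ) : (Complex.Gamma (-(m : ℂ) - 1 / 2))⁻¹ =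
    ((-1) ^ (m + 1) * Real.Gamma (m + 3 / 2) / Real.pi : ℝ) := by
  have h := Complex.Gamma_mul_Gamma_one_sub (-(m : ℂ) - 1 / 2)
  have hpi : (Real.pi : ℂ) ≠ 0 := by exact_mod_cast Real.pi_ne_zero
  have e1 : (1 : ℂ) - (-(m : ℂ) - 1 / 2) = ((m + 3 / 2 : ℝ) : ℂ) := by push_cast; ring
  have e2 : Complex.sin (Real.pi * (-(m : ℂ) - 1 / 2)) = (-1) ^ (m + 1) := by
    have : (Real.pi : ℂ) * (-(m : ℂ) - 1 / 2) = ((-(m * Real.pi + Real.pi / 2) : ℝ) : ℂ) := by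
      push_cast; ring
    rw [this, ← Complex.ofReal_sin, Real.sin_neg, Real.sin_add_pi_div_two, Real.cos_nat_mul_pi]
    push_cast
    ring
  rw [e1, e2, Complex.Gamma_ofReal] at h
  have hsq : ((-1 : ℂ) ^ (m + 1)) * (-1) ^ (m + 1) = 1 := by rw [← mul_pow]; simp
  have hne : ((-1 : ℂ) ^ (m + 1)) ≠ 0 := left_ne_zero_of_mul (hsq ▸ one_ne_zero)
  refine inv_eq_of_mul_eq_one_right ?_
  rw [eq_div_iff hne] at h
  push_cast
  rw [← mul_div_assoc, div_eq_one_iff_eq hpi]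
  linear_combination h

theorem koshliakovZeta_neg_odd (hp : 0 < p) (m : ℕ) : koshliakovZeta p (-2 * (m : ℂ) - 1) =
    ((-1) ^ (m + 1) * Real.Gamma (m + 3 / 2) / Real.pi * thetaMoment p m : ℝ) := by
  have hre : (-2 * (m : ℂ) - 1).re = -(2 * m + 1) := by
    simp; ring
  have h1 : (-2 * (m : ℂ) - 1) ≠ 1 := by
    intro h
    have := congrArg Complex.re h
    rw [hre, Complex.one_re] at this
    have : (0 : ℝ) ≤ m := m.cast_nonneg
    linarith
  have h0 : (-2 * (m : ℂ) - 1) ≠ 0 := by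
    intro h
    have := congrArg Complex.re h
    rw [hre, Complex.zero_re] at this
    have : (0 : ℝ) ≤ m := m.cast_nonneg
    linarith
  have e : (-2 * (m : ℂ) - 1) / 2 = -(m : ℂ) - 1 / 2 := by ring
  have hneg : (-(m : ℂ) - 1 / 2).re < 0 := by
    rw [← e]
    simp
    have : (0 : ℝ) ≤ m := m.cast_nonneg
    linarith
  rw [(isKoshliakovZeta_koshliakovZeta hp).eqOn (isKoshliakovZeta_continuedZeta hp) h1,
    continuedZeta_eq h0, e, ← mellin_theta hp hneg, mellin_theta_eq_thetaMoment,
    inv_Gamma_neg_half_sub, ← Complex.ofReal_mul]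

/-! ### The transformation formula -/

theorem hasSum_koshliakovTerm (hp : 0 < p) {m : ℕ} (hm : 1 ≤ m) {t : ℝ} (ht : 0 < t) :
    HasSum (fun j => koshliakovTerm p (Real.pi * t) m (root p j))
      (t / Real.pi * (∫ u in Ioi (0 : ℝ), theta p 0 u * theta p (m + 1) (t ^ 2 * u)) +
        Real.Gamma (m + 3 / 2) / (2 * Real.pi) * thetaMoment p m / t ^ (2 * m + 2)) := by
  have hpi := Real.pi_pos
  refine (hasSum_weight_mul_psiReal' hp hm ht).congr_fun fun j => ?_
  rw [koshliakovTerm_eq hp m (by positivity) (root_pos hp j), mul_div_cancel_left₀ _ hpi.ne']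

/-- The transformation formula in terms of `t = α / π = π / β`. -/
theorem transformation (hp : 0 < p) {m : ℕ} (hm : 1 ≤ m) {t : ℝ} (ht : 0 < t) :
    (Real.pi * t) ^ (m + 1) *
        (1 / 2 * ((-1) ^ (m + 1) * Real.Gamma (m + 3 / 2) / Real.pi * thetaMoment p m) +
          ∑' j, koshliakovTerm p (Real.pi * t) m (root p j)) =
      (-(Real.pi * t⁻¹)) ^ (m + 1) *
        (1 / 2 * ((-1) ^ (m + 1) * Real.Gamma (m + 3 / 2) / Real.pi * thetaMoment p m) +
          ∑' j, koshliakovTerm p (Real.pi * t⁻¹) m (root p j)) := by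
  have hpi := Real.pi_pos
  have hti : 0 < t⁻¹ := by positivity
  rw [(hasSum_koshliakovTerm hp hm ht).tsum_eq, (hasSum_koshliakovTerm hp hm hti).tsum_eq,
    integral_theta_mul_swap hp hm (by positivity : 0 < t ^ 2), inv_pow t 2]
  set Q := ∫ u in Ioi (0 : ℝ), theta p 0 u * theta p (m + 1) ((t ^ 2)⁻¹ * u)
  set K := Real.Gamma (m + 3 / 2) * thetaMoment p m
  obtain ⟨e, he⟩ : ∃ e : ℝ, e = (-1) ^ (m + 1) := ⟨_, rfl⟩
  have hsq : e * e = 1 := by rw [he, ← mul_pow]; norm_num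
  obtain ⟨T, hT⟩ : ∃ T : ℝ, T = t ^ (m + 1) := ⟨_, rfl⟩
  have hT0 : T ≠ 0 := by rw [hT]; positivity
  have h1 : t ^ (2 * m + 2) = T ^ 2 := by rw [hT]; ring
  have h2 : (-(t ^ 2)⁻¹) ^ (m + 1) = e * (T ^ 2)⁻¹ := by
    rw [neg_pow, inv_pow, hT, he]; ring
  have h3 : (-(Real.pi * t⁻¹)) ^ (m + 1) = e * Real.pi ^ (m + 1) * T⁻¹ := by
    rw [neg_pow, mul_pow, inv_pow, hT, he]; ring
  rw [inv_pow t, h1, h2, h3, mul_pow, ← hT, ← he]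
  have hG : Real.Gamma (m + 3 / 2) / (2 * Real.pi) * thetaMoment p m = K / (2 * Real.pi) := by ring
  have hG2 : e * Real.Gamma (m + 3 / 2) / Real.pi * thetaMoment p m = e * K / Real.pi := by ring
  rw [hG, hG2]
  field_simp
  -- The integrals already match. The zeta term on one side and the moment term on the other agree
  -- up to the square of the sign (−1)^{m+1}.
  linear_combination (-K * t) * hsq

end Koshliakov

theorem mainTheorem9 (p : ℝ) (hp : 0 < p) (m : ℕ) (hm : 1 ≤ m)
    (α β : ℝ) (hα : 0 < α) (hβ : 0 < β) (hαβ : α * β = Real.pi ^ 2) :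
    IsKoshliakovZeta p (koshliakovZeta p) ∧
    Summable (fun j : ℕ => koshliakovTerm p α m (koshliakovRoot p (j + 1))) ∧
    Summable (fun j : ℕ => koshliakovTerm p β m (koshliakovRoot p (j + 1))) ∧
    (α : ℂ) ^ (m + 1) *
        (1 / 2 * koshliakovZeta p (-2 * (m : ℂ) - 1) +
          ((∑' j : ℕ, koshliakovTerm p α m (koshliakovRoot p (j + 1)) : ℝ) : ℂ)) =
      (-(β : ℂ)) ^ (m + 1) *
        (1 / 2 * koshliakovZeta p (-2 * (m : ℂ) - 1) +
          ((∑' j : ℕ, koshliakovTerm p β m (koshliakovRoot p (j + 1)) : ℝ) : ℂ)) := by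
  have hpi := Real.pi_pos
  obtain ⟨t, ht⟩ : ∃ t, t = α / Real.pi := ⟨_, rfl⟩
  have ht0 : 0 < t := by rw [ht]; positivity
  obtain rfl : α = Real.pi * t := by rw [ht]; field_simp
  obtain rfl : β = Real.pi * t⁻¹ := by
    field_simp
    apply mul_left_cancel₀ hpi.ne'
    linear_combination hαβ
  refine ⟨Koshliakov.isKoshliakovZeta_koshliakovZeta hp,
    (Koshliakov.hasSum_koshliakovTerm hp hm ht0).summable,
    (Koshliakov.hasSum_koshliakovTerm hp hm (by positivity : 0 < t⁻¹)).summable, ?_⟩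
  rw [Koshliakov.koshliakovZeta_neg_odd hp m]
  have h := congrArg ((↑) : ℝ → ℂ) (Koshliakov.transformation hp hm ht0)
  push_cast at h ⊢
  exact h
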